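/- **Setting.** Let $d\in\mathbb N$, let $W=C([0,1],\mathbb R^d)$ with the uniform norm $|\cdot|_W$ and its Borel $\sigma$-field $\mathcal B(W)$, and let $W_t(\omega)=\omega(t)$ be the evaluation process. Let $$H=\Big\{h=\int_0^{\cdot}\dot h_s\,ds:\ \int_0^1|\dot h_s|^2ds<\infty\Big\},\qquad \langle h,k\rangle_H=\int_0^1\langle\dot h_s,\dot k_s\rangle ds,\qquad H_{0,0}=\{h\in H:h_0=h_1=0\}.$$ For a Borel probability $\eta$ on $W$, the exponent $\eta$ on a $\sigma$-field denotes its completion by all $\eta$-negligible sets. For a $\mathcal B(W)^\eta/\mathcal B(W)$-measurable map $U:W\to W$ (maps are identified when they agree $\eta$-a.s.), $(\mathcal G^{U}_t)_{t\in[0,1]}$ is the $\eta$-usual augmentation of the filtration $(\sigma(U_s,\,s\le t))_{t\in[0,1]}$, where $U_s=W_s\circ U$, and $(\mathcal F^\eta_t)=(\mathcal G_t^{I_W})$, where $I_W$ is the identity map; $U$ is called $(\mathcal F^\eta_t)$-adapted if $\mathcal G^U_t\subset\mathcal F^\eta_t$ for all $t$. Let $\mathbb S$ be the set of Borel probabilities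 $\nu$ on $W$ under which, $\nu$-a.s., $W_t=W_0+M_t+\int_0^t v_s\,ds$ for all $t\in[0,1]$, where $M$ is an $\mathbb R^d$-valued continuous local martingale on $(W,\mathcal B(W)^\nu,\nu)$ with respect to $(\mathcal F_t^\nu)$, with $M_0=0$ and $\langle M\rangle=\int_0^{\cdot}\alpha_s\,ds$, where $v$ and $\alpha$ are measurable processes whose paths are $\nu$-a.s. Lebesgue integrable on $[0,1]$, and where $\int_0^\cdot v_s\,ds$ and $\int_0^\cdot\alpha_s\,ds$ are $(\mathcal F^\nu_t)$-adapted. Let $L^2_a(\eta,H)$ be the Hilbert space of ($\eta$-a.s. equal classes of) measurable $(\mathcal F_t^\eta)$-adapted $h$ with values in $H$ and $\mathbb E_\eta[|h|_H^2]<\infty$, with norm $\mathbb E_\eta[|h|_H^2]^{1/2}$, and let $L^2_a(\eta,H_{0,0})$ be the set of its elements with $h\in H_{0,0}$ $\eta$-a.s. An $(\mathcal F^\eta_t)$-adapted $U$ is an *isomorphism of filtered probability spaces* if, with $\mu=U_\star\eta$, there is an $(\mathcal F^{\mu}_t)$-adapted $\widetilde U$ such that $\widetilde U\circ U=I_W$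 $\eta$-a.s. and $U\circ\widetilde U=I_W$ $\mu$-a.s. Let $\mathcal I^0_f(\eta)$ be the set of those isomorphisms $U$ for which moreover $\sigma(W_0)^\eta=\sigma(U_0)^\eta$. Put $$V_\eta=\{h\in L^2_a(\eta,H):\ U+h\in\mathcal I^0_f(\eta)\text{ for all }U\in\mathcal I^0_f(\eta)\},$$ $$V_\eta^{\infty,0}=\{h\in V_\eta\cap L^2_a(\eta,H_{0,0}):\ \exists\, C>0,\ |h|_W\le C\ \ \eta\text{-a.s.}\}.$$ For $\nu\in\mathbb S$, the set of average preserving variation processes is $$A_\nu^{\infty,0}=\{h\in V_\nu^{\infty,0}:\ \mathbb E_\nu[h]=0_H\},$$ where $\mathbb E_\nu[h]\in H$ is a Bochner integral. **Proposition.** For every $\nu\in\mathbb S$, the closure of $A_\nu^{\infty,0}$ in $L^2_a(\nu,H)$ is $$\mathrm{cl}(A_\nu^{\infty,0})=\{h\in L^2_a(\nu,H_{0,0}):\ \mathbb E_\nu[h]=0_H\}.$$ -/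

import Mathlib

open MeasureTheory ProbabilityTheory Filter Set
open scoped unitInterval ENNReal

noncomputable section

namespace AvgPreserving

/-! ### The path space `W = C([0,1], ℝ^d)` -/

/-- The path space `W = C([0,1], ℝ^d)` with the norm of uniform convergence. -/
abbrev PathSpace (d : ℕ) : Type := C(I, EuclideanSpace ℝ (Fin d))

/-- The Borel sigma-field of the path space. -/
instance instMeasurableSpacePathSpace (d : ℕ) : MeasurableSpace (PathSpace d) :=
  borel (PathSpace d)

instance instBorelSpacePathSpace (d : ℕ) : BorelSpace (PathSpace d) := ⟨rfl⟩

/-! ### The Cameron-Martin space `H` -/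

/-- `f` is a square integrable velocity of the path `h`: `h_t = ∫_0^t f_s ds` for all `t`. -/
def IsVelocity {d : ℕ} (h : PathSpace d) (f : I → EuclideanSpace ℝ (Fin d)) : Prop :=
  MemLp f 2 (volume : Measure I) ∧ ∀ t : I, h t = ∫ s in Set.Icc 0 t, f s

/-- The set of all paths which are the primitive of a square integrable velocity, as a linear
subspace of the path space. -/
def cameronMartinPaths (d : ℕ) : Submodule ℝ (PathSpace d) where
  carrier := {h | ∃ f, IsVelocity h f}
  zero_mem' := ⟨fun _ => 0, MemLp.zero, fun t => by simp⟩
  add_mem' := by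
    rintro h k ⟨f, hf, hf'⟩ ⟨g, hg, hg'⟩
    refine ⟨fun s => f s + g s, hf.add hg, fun t => ?_⟩
    rw [integral_add (hf.integrable one_le_two).integrableOn
      (hg.integrable one_le_two).integrableOn, ContinuousMap.add_apply, hf', hg']
  smul_mem' := by
    rintro c h ⟨f, hf, hf'⟩
    refine ⟨fun s => c • f s, hf.const_smul c, fun t => ?_⟩
    rw [integral_smul, ContinuousMap.smul_apply, hf']

/-- The Cameron-Martin space `H`. This is a type of its own, so that it does not carry the
uniform norm but the norm `|h|_H` of the velocity in `L²`, see below. -/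
def CameronMartin (d : ℕ) : Type := ↥(cameronMartinPaths d)

namespace CameronMartin

variable {d : ℕ}

instance : AddCommGroup (CameronMartin d) := inferInstanceAs (AddCommGroup ↥(cameronMartinPaths d))

instance : Module ℝ (CameronMartin d) := inferInstanceAs (Module ℝ ↥(cameronMartinPaths d))

/-- The underlying path of an element of `H`. -/
def path : CameronMartin d →ₗ[ℝ] PathSpace d := (cameronMartinPaths d).subtype

theorem path_injective : Function.Injective (path (d := d)) := Subtype.val_injective

theorem exists_isVelocity (h : CameronMartin d) : ∃ f, IsVelocity (path h) f := h.2

/-- The velocity is unique up to a Lebesgue-null set. -/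
theorem ae_eq_of_isVelocity {h : PathSpace d} {f g : I → EuclideanSpace ℝ (Fin d)}
    (hf : IsVelocity h f) (hg : IsVelocity h g) : f =ᵐ[volume] g := by
  have hfi := hf.1.integrable one_le_two
  have hgi := hg.1.integrable one_le_two
  have hi : Integrable (fun s => f s - g s) volume := hfi.sub hgi
  have hIic : ∀ t : I, ∫ s in Set.Iic t, (f s - g s) = 0 := by
    intro t
    have e : Set.Iic t = Set.Icc 0 t := by
      ext s; simp
    rw [e, integral_sub hfi.integrableOn hgi.integrableOn, ← hf.2, ← hg.2, sub_self]
  have huniv : ∫ s, (f s - g s) = 0 := by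
    have h1 := hIic 1
    rwa [show Set.Iic (1 : I) = Set.univ from eq_univ_of_forall fun s => s.2.2,
      setIntegral_univ] at h1
  have hall : ∀ s : Set I, MeasurableSet s → ∫ x in s, (f x - g x) = 0 := by
    intro s hs
    induction s, hs using MeasurableSpace.induction_on_inter (borel_eq_generateFrom_Iic I ▸
      BorelSpace.measurable_eq) isPiSystem_Iic with
    | empty => simp
    | basic u hu => obtain ⟨t, rfl⟩ := hu; exact hIic t
    | compl u hu ih => rw [setIntegral_compl hu hi, ih, huniv, sub_zero]
    | iUnion u hd hu ih => rw [integral_iUnion hu hd hi.integrableOn]; simp [ih]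
  have := hi.ae_eq_zero_of_forall_setIntegral_eq_zero (fun s hs _ => hall s hs)
  filter_upwards [this] with x hx using sub_eq_zero.1 hx

theorem continuous_primitive {f : I → EuclideanSpace ℝ (Fin d)}
    (hf : Integrable f (volume : Measure I)) : Continuous fun t : I => ∫ s in Set.Icc 0 t, f s := by
  simp_rw [← integral_indicator measurableSet_Icc]
  refine continuous_iff_continuousAt.2 fun t => ?_
  refine continuousAt_of_dominated (bound := fun s => ‖f s‖) ?_ ?_ hf.norm ?_
  · exact .of_forall fun u => hf.aestronglyMeasurable.indicator measurableSet_Icc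
  · exact .of_forall fun u => .of_forall fun s => norm_indicator_le_norm_self _ _
  · have : ∀ᵐ s : I, s ≠ t := by simp [ae_iff]
    filter_upwards [this] with s hs
    rcases lt_or_gt_of_ne hs with h | h
    · have : (fun u : I => (Set.Icc 0 u).indicator f s) =ᶠ[nhds t] fun _ => f s := by
        filter_upwards [lt_mem_nhds h] with u hu
        exact indicator_of_mem (show s ∈ Set.Icc 0 u from ⟨s.2.1, hu.le⟩) f
      exact continuousAt_const.congr this.symm
    · have : (fun u : I => (Set.Icc 0 u).indicator f s) =ᶠ[nhds t] fun _ => 0 := by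
        filter_upwards [gt_mem_nhds h] with u hu
        exact indicator_of_notMem (fun hm => absurd hm.2 (not_le.2 hu)) f
      exact continuousAt_const.congr this.symm

/-- The velocity `ḣ` of an element of `H`, as a class of functions. -/
def vel (h : CameronMartin d) : Lp (EuclideanSpace ℝ (Fin d)) 2 (volume : Measure I) :=
  (exists_isVelocity h).choose_spec.1.toLp _

theorem isVelocity_vel (h : CameronMartin d) : IsVelocity (path h) (vel h) := by
  have hs := (exists_isVelocity h).choose_spec
  refine ⟨Lp.memLp _, fun t => ?_⟩
  rw [hs.2 t]
  exact integral_congr_ae (ae_restrict_of_ae hs.1.coeFn_toLp.symm)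

theorem vel_eq_of_isVelocity {h : CameronMartin d}
    {f : Lp (EuclideanSpace ℝ (Fin d)) 2 (volume : Measure I)}
    (hf : IsVelocity (path h) f) : vel h = f :=
  Lp.ext (ae_eq_of_isVelocity (isVelocity_vel h) hf)

/-- `h ↦ ḣ` is a linear bijection of `H` onto `L²([0,1], ℝ^d)`. -/
def velEquiv : CameronMartin d ≃ₗ[ℝ] Lp (EuclideanSpace ℝ (Fin d)) 2 (volume : Measure I) :=
  LinearEquiv.ofBijective
    { toFun := vel
      map_add' := fun h k => by
        refine vel_eq_of_isVelocity ⟨Lp.memLp _, fun t => ?_⟩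
        have hh := isVelocity_vel h
        have hk := isVelocity_vel k
        rw [integral_congr_ae (ae_restrict_of_ae (Lp.coeFn_add (vel h) (vel k))), map_add,
          ContinuousMap.add_apply, hh.2, hk.2]
        exact (integral_add (hh.1.integrable one_le_two).integrableOn
          (hk.1.integrable one_le_two).integrableOn).symm
      map_smul' := fun c h => by
        refine vel_eq_of_isVelocity ⟨Lp.memLp _, fun t => ?_⟩
        have hh := isVelocity_vel h
        rw [RingHom.id_apply, integral_congr_ae (ae_restrict_of_ae (Lp.coeFn_smul c (vel h))),
          map_smul, ContinuousMap.smul_apply, hh.2]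
        exact (integral_smul c _).symm }
    ⟨fun h k hhk => by
      have hhk' : vel h = vel k := hhk
      refine path_injective (ContinuousMap.ext fun t => ?_)
      rw [(isVelocity_vel h).2, (isVelocity_vel k).2, hhk'],
    fun f => by
      have hf : IsVelocity ⟨_, continuous_primitive ((Lp.memLp f).integrable one_le_two)⟩ f :=
        ⟨Lp.memLp f, fun t => rfl⟩
      exact ⟨⟨_, f, hf⟩, vel_eq_of_isVelocity hf⟩⟩

/-- The norm `|h|_H = ‖ḣ‖_{L²}`. -/
instance : NormedAddCommGroup (CameronMartin d) :=
  NormedAddCommGroup.induced _ _ velEquiv velEquiv.injective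

theorem norm_eq (h : CameronMartin d) : ‖h‖ = ‖vel h‖ := rfl

/-- The scalar product `⟨h, k⟩_H = ∫_0^1 ⟨ḣ_s, k̇_s⟩ ds`. -/
instance : InnerProductSpace ℝ (CameronMartin d) where
  norm_smul_le c h := by
    change ‖velEquiv (c • h)‖ ≤ ‖c‖ * ‖velEquiv h‖
    rw [map_smul, norm_smul]
  inner h k := ∫ s : I, inner ℝ (vel h s) (vel k s)
  norm_sq_eq_re_inner h := norm_sq_eq_re_inner (𝕜 := ℝ) (vel h)
  conj_inner_symm h k := inner_conj_symm (𝕜 := ℝ) (vel h) (vel k)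
  add_left h k l := by
    change inner ℝ (velEquiv (h + k)) (velEquiv l) =
      inner ℝ (velEquiv h) (velEquiv l) + inner ℝ (velEquiv k) (velEquiv l)
    rw [map_add, inner_add_left]
  smul_left h k c := by
    change inner ℝ (velEquiv (c • h)) (velEquiv k) = _ * inner ℝ (velEquiv h) (velEquiv k)
    rw [map_smul, inner_smul_left]

instance : CompleteSpace (CameronMartin d) := by
  have hiso : Isometry (velEquiv (d := d)) := AddMonoidHomClass.isometry_of_norm _ fun _ => rfl
  exact (completeSpace_congr (e := velEquiv.toEquiv) hiso.isUniformEmbedding).2 inferInstance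

/-- The subspace `H_{0,0}` of all `h ∈ H` with `h_0 = h_1 = 0`. -/
def pinned (d : ℕ) : Submodule ℝ (CameronMartin d) where
  carrier := {h | path h 0 = 0 ∧ path h 1 = 0}
  zero_mem' := by simp
  add_mem' := by
    rintro h k ⟨h0, h1⟩ ⟨k0, k1⟩
    simp [h0, h1, k0, k1]
  smul_mem' := by
    rintro c h ⟨h0, h1⟩
    simp [h0, h1]

end CameronMartin

/-! ### Filtrations on the path space -/

section Filtrations

variable {d : ℕ}

/-- The completion `m^η` of a sigma-field `m`, that is, the sigma-field generated by `m` and all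
`η`-negligible sets (subsets of Borel sets of measure zero). -/
@[reducible] def completed (η : Measure (PathSpace d)) (m : MeasurableSpace (PathSpace d)) :
    MeasurableSpace (PathSpace d) :=
  eventuallyMeasurableSpace m (ae η)

/-- The `η`-usual augmentation `⋂_{s > t} σ(X_u, u ≤ s)^η` of the filtration generated by a process
`X` on the path space; at the terminal time `t = 1` it is `σ(X_u, u ≤ 1)^η`. -/
@[reducible] def usualAugmentation (η : Measure (PathSpace d))
    (X : I → PathSpace d → EuclideanSpace ℝ (Fin d)) (t : I) : MeasurableSpace (PathSpace d) :=
  ⨅ (s : I) (_ : t < s ∨ s = 1),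
    completed η (⨆ (u : I) (_ : u ≤ s), MeasurableSpace.comap (X u) inferInstance)

/-- The filtration `(𝒢_t^U)` generated by a map `U` of the path space to itself. -/
@[reducible] def generatedFiltration (η : Measure (PathSpace d)) (U : PathSpace d → PathSpace d)
    (t : I) : MeasurableSpace (PathSpace d) :=
  usualAugmentation η (fun s ω => U ω s) t

/-- The filtration `(ℱ_t^η)` generated by the evaluation process `W_t(ω) = ω(t)`. -/
@[reducible] def evalFiltration (η : Measure (PathSpace d)) (t : I) :
    MeasurableSpace (PathSpace d) :=
  usualAugmentation η (fun s ω => ω s) t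

theorem evalFiltration_mono (η : Measure (PathSpace d)) {s t : I} (hst : s ≤ t) :
    evalFiltration η s ≤ evalFiltration η t :=
  le_iInf₂ fun r hr => iInf₂_le r (hr.imp_left hst.trans_lt)

theorem evalFiltration_le (η : Measure (PathSpace d)) (t : I) :
    evalFiltration η t ≤ completed η inferInstance := by
  refine (iInf₂_le (1 : I) (Or.inr rfl)).trans ?_
  rintro A ⟨B, hB, hAB⟩
  refine ⟨B, ?_, hAB⟩
  refine (iSup₂_le fun u _ => Measurable.comap_le ?_ : (⨆ (u : I) (_ : u ≤ 1), _) ≤ _) B hB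
  exact (continuous_eval_const u).measurable

theorem measurable_evalFiltration_congr {η : Measure (PathSpace d)} {t : I}
    {f g : PathSpace d → EuclideanSpace ℝ (Fin d)} (hf : Measurable[evalFiltration η t] f)
    (hfg : g =ᵐ[η] f) : Measurable[evalFiltration η t] g := by
  intro A hA
  have h := hf hA
  simp only [MeasurableSpace.measurableSet_iInf] at h ⊢
  intro s hs
  exact EventuallyMeasurableSet.congr (h s hs) (hfg.preimage A)

/-- `(ℱ_t^η)` as a filtration of the completed Borel sigma-field. -/
def evalFilt (η : Measure (PathSpace d)) :
    @Filtration (PathSpace d) I _ (completed η inferInstance) :=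
  @Filtration.mk _ _ _ (completed η inferInstance) (evalFiltration η)
    (fun _ _ h => evalFiltration_mono η h) (evalFiltration_le η)

/-- The extension of `η` to the completed Borel sigma-field. -/
def completedMeasure (η : Measure (PathSpace d)) :
    @Measure (PathSpace d) (completed η inferInstance) :=
  η.completion

end Filtrations

/-! ### Laws of continuous semi-martingales -/

section Semimartingales

variable {d : ℕ}

/-- `X` is a local martingale on `(W, 𝓑(W)^ν, ν)` with respect to `(ℱ_t^ν)`. -/
def IsLocalMartingale (ν : Measure (PathSpace d)) (X : I → PathSpace d → ℝ) : Prop :=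
  @Locally I (PathSpace d) ℝ (completed ν inferInstance) _ _ _ _ _
    (fun Y => @Martingale (PathSpace d) ℝ I _ (completed ν inferInstance) _ _
      Y (evalFilt ν) (completedMeasure ν))
    (evalFilt ν) X (completedMeasure ν)

/-- `X` is a measurable process on `(W, 𝓑(W)^ν)`. -/
def IsMeasurableProcess {F : Type*} [MeasurableSpace F] (ν : Measure (PathSpace d))
    (X : I → PathSpace d → F) : Prop :=
  @Measurable (I × PathSpace d) F
    (@Prod.instMeasurableSpace I (PathSpace d) _ (completed ν inferInstance)) _
    fun p => X p.1 p.2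

/-- The set `𝕊` of the laws of continuous semi-martingales under which the evaluation process has
the form `W_t = W_0 + M_t + ∫_0^t v_s ds`, where `M` is a continuous local martingale with
`M_0 = 0` and `⟨M⟩ = ∫_0^. α_s ds`. -/
def semimartingaleLaws (d : ℕ) : Set (Measure (PathSpace d)) :=
  {ν | IsProbabilityMeasure ν ∧
    ∃ (v : I → PathSpace d → EuclideanSpace ℝ (Fin d))
      (α : I → PathSpace d → Fin d → Fin d → ℝ)
      (M : I → PathSpace d → EuclideanSpace ℝ (Fin d)),
      IsMeasurableProcess ν v ∧ IsMeasurableProcess ν α ∧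
      (∀ᵐ ω ∂ν, Integrable (fun s => v s ω) volume) ∧
      (∀ᵐ ω ∂ν, ∀ i j, Integrable (fun s => α s ω i j) volume) ∧
      (∀ t, Measurable[evalFiltration ν t] fun ω => ∫ s in Set.Icc 0 t, v s ω) ∧
      (∀ t i j, Measurable[evalFiltration ν t] fun ω => ∫ s in Set.Icc 0 t, α s ω i j) ∧
      (∀ ω, Continuous fun t => M t ω) ∧ (∀ ω, M 0 ω = 0) ∧
      (∀ i, IsLocalMartingale ν fun t ω => M t ω i) ∧
      (∀ i j, IsLocalMartingale ν fun t ω =>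
        M t ω i * M t ω j - ∫ s in Set.Icc 0 t, α s ω i j) ∧
      ∀ᵐ ω ∂ν, ∀ t, ω t = ω 0 + M t ω + ∫ s in Set.Icc 0 t, v s ω}

end Semimartingales

/-! ### Information flows preserving maps -/

section Isomorphisms

variable {d : ℕ}

/-- `U` represents an `(ℱ_t^η)`-adapted element of `M_η((W, 𝓑(W)^η), (W, 𝓑(W)))`. -/
def IsAdaptedMap (η : Measure (PathSpace d)) (U : PathSpace d → PathSpace d) : Prop :=
  AEMeasurable U η ∧ ∀ t, generatedFiltration η U t ≤ evalFiltration η t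

/-- `U` is an isomorphism of filtered probability spaces. -/
def IsFilteredIso (η : Measure (PathSpace d)) (U : PathSpace d → PathSpace d) : Prop :=
  IsAdaptedMap η U ∧ ∃ V : PathSpace d → PathSpace d, IsAdaptedMap (η.map U) V ∧
    (∀ᵐ ω ∂η, V (U ω) = ω) ∧ ∀ᵐ ω ∂η.map U, U (V ω) = ω

/-- The set `ℐ_f^0(η)` of the isomorphisms of filtered probability spaces with
`σ(W_0)^η = σ(U_0)^η`. -/
def isoZero (η : Measure (PathSpace d)) : Set (PathSpace d → PathSpace d) :=
  {U | IsFilteredIso η U ∧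
    completed η (MeasurableSpace.comap (fun ω : PathSpace d => ω 0) inferInstance) =
      completed η (MeasurableSpace.comap (fun ω => U ω 0) inferInstance)}

end Isomorphisms

/-! ### Variation processes -/

section Variations

variable {d : ℕ}

/-- The space `L²_a(η, H)`: the classes of square integrable, `(ℱ_t^η)`-adapted `H`-valued random
variables, a subspace of the Bochner space `L²(η, H)` with the norm `E_η[|h|_H²]^{1/2}`. -/
def adaptedL2 (η : Measure (PathSpace d)) : Submodule ℝ (Lp (CameronMartin d) 2 η) where
  carrier := {h | ∀ t, Measurable[evalFiltration η t] fun ω => (h ω).path t}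
  zero_mem' := fun t => by
    refine measurable_evalFiltration_congr (f := fun _ => 0) (@measurable_const _ _ _ _ 0) ?_
    filter_upwards [Lp.coeFn_zero (CameronMartin d) 2 η] with ω hω
    rw [hω, Pi.zero_apply, map_zero, ContinuousMap.zero_apply]
  add_mem' := by
    intro h k hh hk t
    refine measurable_evalFiltration_congr ((hh t).add (hk t)) ?_
    filter_upwards [Lp.coeFn_add h k] with ω hω
    rw [hω, Pi.add_apply, map_add, ContinuousMap.add_apply]
    rfl
  smul_mem' := by
    intro c h hh t
    refine measurable_evalFiltration_congr ((hh t).const_smul c) ?_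
    filter_upwards [Lp.coeFn_smul c h] with ω hω
    rw [hω, Pi.smul_apply, map_smul, ContinuousMap.smul_apply]
    rfl

/-- The subset `L²_a(η, H_{0,0})` of `L²_a(η, H)`. -/
def adaptedL2Pinned (η : Measure (PathSpace d)) : Set (adaptedL2 η) :=
  {h | ∀ᵐ ω ∂η, (h : Lp (CameronMartin d) 2 η) ω ∈ CameronMartin.pinned d}

/-- The set `V_η` of variation processes: those `h ∈ L²_a(η, H)` such that `U + h` is in
`ℐ_f^0(η)` for all `U` in `ℐ_f^0(η)`. -/
def variationProcesses (η : Measure (PathSpace d)) : Set (adaptedL2 η) :=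
  {h | ∀ U ∈ isoZero η, (fun ω => U ω + ((h : Lp (CameronMartin d) 2 η) ω).path) ∈ isoZero η}

/-- The set `V_η^∞` of the variation processes which are bounded in the uniform norm. -/
def boundedVariations (η : Measure (PathSpace d)) : Set (adaptedL2 η) :=
  {h | h ∈ variationProcesses η ∧
    ∃ C : ℝ, 0 < C ∧ ∀ᵐ ω ∂η, ‖((h : Lp (CameronMartin d) 2 η) ω).path‖ ≤ C}

/-- The set `V_η^{∞,0}` of the bounded variation processes with values in `H_{0,0}`. -/
def boundedPinnedVariations (η : Measure (PathSpace d)) : Set (adaptedL2 η) :=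
  boundedVariations η ∩ adaptedL2Pinned η

/-- The mean `E_η[h] ∈ H`, a Bochner integral. -/
def mean (η : Measure (PathSpace d)) (h : adaptedL2 η) : CameronMartin d :=
  ∫ ω, (h : Lp (CameronMartin d) 2 η) ω ∂η

/-- The set `A_ν^{∞,0}` of average preserving variation processes. -/
def avgPreserving (ν : Measure (PathSpace d)) : Set (adaptedL2 ν) :=
  {h | h ∈ boundedPinnedVariations ν ∧ mean ν h = 0}

end Variations

end AvgPreserving

end

/-! ### Density of the centered delayed processes

`H_{0,0}` is closed in `H` and the mean is continuous, so only the density of the average preserving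
variation processes has to be shown.

*Delayed processes are variation processes.* A map `U` is an isomorphism of filtered probability
spaces exactly if it generates the same augmented filtration as the evaluation process
(`isFilteredIso_iff`). Let `h = ∑ i, ψ i • g i` plus a deterministic path, where the scalar function
`ψ i` vanishes up to time `s i` and the random vector `g i` is already known at a time `p i < s i`.
Then `U` can be recovered in an adapted way from `U + h`: on `[0, s i]` only the `g j` with
`s j < s i` contribute to `h`, and by induction these are known, hence so is `U` on `[0, s i]`, and
with it `g i` (`usualAugmentation_le_of_delayed`). So `U + h` generates the same filtration as `U`,
and `h` is a variation process (`mem_variationProcesses_of_delayed`).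

*Delayed processes are dense.* On the grid of mesh `1 / (n + 3)`, reproduce each increment of
`h ∈ H_{0,0}` linearly two cells later, and go back to zero on the last cell. This is a pinned
delayed path, and on the level of velocities it is the operator `delayedAverage n` on `L²`. These operators
are bounded by `3` uniformly in `n` and converge strongly to the identity
(`tendsto_delayedAverage`).
Truncating the increments makes the process bounded, and by dominated convergence the truncation can
be removed afterwards.

*Centering.* The mean of a pinned process is a deterministic element of `H_{0,0}`. Subtracting it
preserves all the properties above, so the centered approximations are average preserving, and they
converge to `h - E[h] = h` if `E[h] = 0`.
-/

open MeasureTheory ProbabilityTheory Filter Set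
open scoped unitInterval ENNReal Topology

noncomputable section

namespace AvgPreserving

open CameronMartin

variable {d : ℕ} {η : Measure (PathSpace d)}
variable {X Y : I → PathSpace d → EuclideanSpace ℝ (Fin d)}

/-! ### Completions and augmentations -/

/-- The raw past `σ(X_u, u ≤ s)` of a process on the path space. -/
@[reducible] def past (X : I → PathSpace d → EuclideanSpace ℝ (Fin d)) (s : I) :
    MeasurableSpace (PathSpace d) :=
  ⨆ (u : I) (_ : u ≤ s), MeasurableSpace.comap (X u) inferInstance

theorem le_completed (m : MeasurableSpace (PathSpace d)) : m ≤ completed η m :=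
  le_eventuallyMeasurableSpace

theorem completed_mono {m m' : MeasurableSpace (PathSpace d)} (h : m ≤ m') :
    completed η m ≤ completed η m' := by
  rintro A ⟨B, hB, hAB⟩
  exact ⟨B, h B hB, hAB⟩

theorem completed_completed_le (m : MeasurableSpace (PathSpace d)) :
    completed η (completed η m) ≤ completed η m := by
  rintro A ⟨B, ⟨C, hC, hBC⟩, hAB⟩
  exact ⟨C, hC, hAB.trans hBC⟩

theorem usualAugmentation_le_completed {s t : I} (h : t < s ∨ s = 1) :
    usualAugmentation η X t ≤ completed η (past X s) :=
  iInf₂_le s h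

theorem usualAugmentation_mono {s t : I} (hst : s ≤ t) :
    usualAugmentation η X s ≤ usualAugmentation η X t :=
  le_iInf₂ fun r hr => iInf₂_le r (hr.imp_left hst.trans_lt)

theorem completed_usualAugmentation_le (t : I) :
    completed η (usualAugmentation η X t) ≤ usualAugmentation η X t :=
  le_iInf₂ fun s hs => (completed_mono (iInf₂_le s hs)).trans (completed_completed_le _)

theorem iInf_usualAugmentation_le (t : I) :
    ⨅ (s : I) (_ : t < s ∨ s = 1), usualAugmentation η X s ≤ usualAugmentation η X t := by
  refine le_iInf₂ fun r hr => ?_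
  rcases hr with hr | rfl
  · obtain ⟨s, hts, hsr⟩ := exists_between hr
    exact (iInf₂_le s (Or.inl hts)).trans (iInf₂_le r (Or.inl hsr))
  · exact (iInf₂_le (1 : I) (Or.inr rfl)).trans (iInf₂_le (1 : I) (Or.inr rfl))

theorem measurable_past {u s : I} (hus : u ≤ s) : Measurable[past X s] (X u) :=
  measurable_iff_comap_le.2 (le_iSup₂_of_le u hus le_rfl)

theorem measurable_usualAugmentation {u t : I} (hut : u ≤ t) :
    Measurable[usualAugmentation η X t] (X u) := by
  have : past X u ≤ usualAugmentation η X t := by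
    refine le_iInf₂ fun s hs => le_trans ?_ (le_completed _)
    have hus : u ≤ s := by
      rcases hs with hs | rfl
      · exact hut.trans hs.le
      · exact u.2.2
    exact iSup₂_le fun r hr => le_iSup₂_of_le r (hr.trans hus) le_rfl
  exact (measurable_past le_rfl).mono this le_rfl

/-- Augmented filtrations are right-continuous and complete, so that they can be compared at each
fixed time through the values of the generating process. -/
theorem usualAugmentation_le_of_measurable
    (h : ∀ u, Measurable[usualAugmentation η Y u] (X u)) (t : I) :
    usualAugmentation η X t ≤ usualAugmentation η Y t := by
  refine le_trans (le_iInf₂ fun s hs => ?_) (iInf_usualAugmentation_le t)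
  refine (usualAugmentation_le_completed hs).trans
    ((completed_mono ?_).trans (completed_usualAugmentation_le s))
  exact iSup₂_le fun u hu => ((h u).mono (usualAugmentation_mono hu) le_rfl).comap_le

theorem measurable_usualAugmentation_congr {t : I} {f g : PathSpace d → EuclideanSpace ℝ (Fin d)}
    (hf : Measurable[usualAugmentation η X t] f) (hgf : g =ᵐ[η] f) :
    Measurable[usualAugmentation η X t] g := fun A hA =>
  completed_usualAugmentation_le t _ ⟨f ⁻¹' A, hf hA, hgf.preimage A⟩

/-- The past of the process `U` is the preimage under `U` of the past of the evaluation process. -/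
theorem past_comp (U : PathSpace d → PathSpace d) (s : I) :
    past (fun u ω => U ω u) s = MeasurableSpace.comap U (past (fun u ω => ω u) s) := by
  simp only [past, MeasurableSpace.comap_iSup, MeasurableSpace.comap_comp]
  rfl

/-- The evaluations generate the Borel sigma-field: by the Lusin-Souslin theorem, countably many
evaluations at a dense set of times form a measurable embedding. -/
theorem borel_le_past_one :
    instMeasurableSpacePathSpace d ≤ past (fun u (ω : PathSpace d) => ω u) 1 := by
  let F : PathSpace d → ℕ → EuclideanSpace ℝ (Fin d) := fun ω n => ω (TopologicalSpace.denseSeq I n)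
  have hF : Measurable F :=
    measurable_pi_lambda _ fun n => (continuous_eval_const _).measurable
  have hinj : Function.Injective F := fun ω ω' h => by
    exact DFunLike.coe_injective
      ((TopologicalSpace.denseRange_denseSeq I).equalizer ω.continuous ω'.continuous h)
  rw [← (hF.measurableEmbedding hinj).comap_eq]
  refine Measurable.comap_le (@measurable_pi_lambda _ _ _ (past (fun u ω => ω u) 1) _ F fun n => ?_)
  exact measurable_past (X := fun u (ω : PathSpace d) => ω u) unitInterval.le_one'

theorem past_one_eq : past (fun u (ω : PathSpace d) => ω u) 1 = instMeasurableSpacePathSpace d :=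
  le_antisymm (iSup₂_le fun u _ => (continuous_eval_const u).measurable.comap_le) borel_le_past_one

theorem past_le (s : I) :
    past (fun u (ω : PathSpace d) => ω u) s ≤ instMeasurableSpacePathSpace d :=
  iSup₂_le fun u _ => (continuous_eval_const u).measurable.comap_le

/-- The Doob-Dynkin lemma up to null sets: a function which is measurable for the completion of
`σ(U)` is almost surely a measurable function of `U`. -/
theorem exists_measurable_comp_ae_eq {Z : Type*} [Nonempty Z] [TopologicalSpace Z]
    [TopologicalSpace.IsCompletelyMetrizableSpace Z] {U : PathSpace d → PathSpace d}
    {g : PathSpace d → Z}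
    (hg : StronglyMeasurable[completed η (MeasurableSpace.comap U inferInstance)] g) :
    ∃ h : PathSpace d → Z, StronglyMeasurable h ∧ g =ᵐ[η] h ∘ U := by
  let mX : MeasurableSpace (PathSpace d) := completed η (MeasurableSpace.comap U inferInstance)
  induction g, hg using StronglyMeasurable.induction' with
  | const z => exact ⟨fun _ ↦ z, stronglyMeasurable_const, .rfl⟩
  | @pcw g₁ g₂ s hg₁ hg₂ hs h₁ h₂ =>
    obtain ⟨_, ⟨t, ht, rfl⟩, hst⟩ := hs
    obtain ⟨h₁, mh₁, hh₁⟩ := h₁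
    obtain ⟨h₂, mh₂, hh₂⟩ := h₂
    classical
    refine ⟨t.piecewise h₁ h₂, mh₁.piecewise ht mh₂, ?_⟩
    filter_upwards [hst.mem_iff, hh₁, hh₂] with ω h1 h2 h3
    by_cases hω : ω ∈ s
    · simpa [Set.piecewise, hω, show U ω ∈ t from h1.1 hω] using h2
    · simpa [Set.piecewise, hω, show U ω ∉ t from fun h => hω (h1.2 h)] using h3
  | @lim g i hg hi h₁ h₂ =>
    choose h mh hh using h₁
    -- Almost every `U ω` lies in the set of convergence, so the default value of `limUnder`
    -- elsewhere is harmless.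
    refine ⟨fun y ↦ limUnder atTop (h · y),
      @StronglyMeasurable.limUnder _ _ _ (_) _ _ _ _ _ _ _ mh, ?_⟩
    filter_upwards [ae_all_iff.2 hh] with ω hω
    rw [Function.comp_apply, Tendsto.limUnder_eq]
    simpa [hω] using h₂ ω

/-! ### Isomorphisms of filtered probability spaces -/

theorem measurable_comp_of_evalFiltration_map {U : PathSpace d → PathSpace d}
    (hU : AEMeasurable U η) {t : I} {f : PathSpace d → EuclideanSpace ℝ (Fin d)}
    (hf : Measurable[evalFiltration (η.map U) t] f) :
    Measurable[generatedFiltration η U t] (f ∘ U) := by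
  intro A hA
  have h := hf hA
  simp only [MeasurableSpace.measurableSet_iInf] at h ⊢
  intro s hs
  obtain ⟨B, hB, hAB⟩ := h s hs
  refine ⟨U ⁻¹' B, ?_, ?_⟩
  · change MeasurableSet[past (fun u ω => U ω u) s] _
    rw [past_comp]
    exact ⟨B, hB, rfl⟩
  · exact (Measure.tendsto_ae_map hU).eventually hAB

/-- Isomorphisms of filtered probability spaces are the maps which generate, up to null sets, the
same filtration as the evaluation process. -/
theorem isFilteredIso_iff [IsProbabilityMeasure η] {U : PathSpace d → PathSpace d} :
    IsFilteredIso η U ↔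
      AEMeasurable U η ∧ ∀ t, generatedFiltration η U t = evalFiltration η t := by
  constructor
  · rintro ⟨⟨hU, hUle⟩, V, ⟨hV, hVle⟩, hVU, -⟩
    refine ⟨hU, fun t => le_antisymm (hUle t) (usualAugmentation_le_of_measurable (fun u => ?_) t)⟩
    have hVu : Measurable[evalFiltration (η.map U) u] fun ω => V ω u :=
      (measurable_usualAugmentation (X := fun u ω => V ω u) le_rfl).mono (hVle u) le_rfl
    refine measurable_usualAugmentation_congr (measurable_comp_of_evalFiltration_map hU hVu) ?_
    filter_upwards [hVU] with ω hω
    simp [hω]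
  · rintro ⟨hU, hUeq⟩
    refine ⟨⟨hU, fun t => (hUeq t).le⟩, ?_⟩
    -- The path itself is a function of `U` up to null sets, which yields the candidate inverse.
    have hid : Measurable[completed η (MeasurableSpace.comap U inferInstance)]
        (id : PathSpace d → PathSpace d) := by
      refine measurable_iff_comap_le.2 ?_
      rw [MeasurableSpace.comap_id]
      calc instMeasurableSpacePathSpace d
          ≤ past (fun u ω => ω u) 1 := borel_le_past_one
        _ ≤ evalFiltration η 1 := iSup₂_le fun u hu =>
            (measurable_usualAugmentation (X := fun u ω => ω u) hu).comap_le
        _ = generatedFiltration η U 1 := (hUeq 1).symm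
        _ ≤ completed η (past (fun u ω => U ω u) 1) := usualAugmentation_le_completed (.inr rfl)
        _ = _ := by rw [past_comp, past_one_eq]
    obtain ⟨V, hVm, hV⟩ := exists_measurable_comp_ae_eq hid.stronglyMeasurable
    have hVm' : Measurable V := hVm.measurable
    have hVU : ∀ᵐ ω ∂η, V (U ω) = ω := by
      filter_upwards [hV] with ω hω using hω.symm
    have hmap : (η.map U).map V = η := by
      rw [AEMeasurable.map_map_of_aemeasurable hVm'.aemeasurable hU,
        Measure.map_congr (f := V ∘ U) (g := id) hVU, Measure.map_id]
    refine ⟨V, ⟨hVm'.aemeasurable, usualAugmentation_le_of_measurable fun u => ?_⟩, hVU, ?_⟩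
    · -- On an event of `σ(V_u)`, composing with `U` gives an event of the evaluation process at
      -- time `u`, hence the preimage under `U` of an event of the past.
      intro A hA
      have hWu : Measurable[generatedFiltration η U u] fun ω : PathSpace d => ω u := by
        rw [hUeq]
        exact measurable_usualAugmentation (X := fun u ω => ω u) le_rfl
      have h := hWu hA
      simp only [MeasurableSpace.measurableSet_iInf] at h ⊢
      intro s hs
      obtain ⟨B, hB, hAB⟩ := h s hs
      change MeasurableSet[past (fun u ω => U ω u) s] B at hB
      rw [past_comp] at hB
      obtain ⟨C, hC, rfl⟩ := hB
      refine ⟨C, hC, ?_⟩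
      have hVA : MeasurableSet ((fun ω => V ω u) ⁻¹' A) :=
        ((continuous_eval_const u).measurable.comp hVm') hA
      refine eventuallyEq_set.2 ((ae_map_iff hU ?_).2 ?_)
      · exact hVA.iff (past_le s _ hC)
      · filter_upwards [hAB.mem_iff, hVU] with ω h1 h2
        simpa [h2] using h1
    · have hUV : AEMeasurable (fun ω => U (V ω)) (η.map U) := by
        refine AEMeasurable.comp_aemeasurable (g := U) (f := V) ?_ hVm'.aemeasurable
        rwa [hmap]
      have hnull : NullMeasurableSet {ω | U (V ω) = ω} (η.map U) :=
        nullMeasurableSet_eq_fun hUV aemeasurable_id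
      change η.map U {ω | U (V ω) = ω}ᶜ = 0
      rw [Measure.map_apply₀ hU hnull.compl]
      refine measure_mono_null (t := {ω | V (U ω) = ω}ᶜ) (fun ω hω hVω => hω ?_) hVU
      change U (V (U ω)) = U ω
      rw [show V (U ω) = ω from hVω]

/-! ### The embedding of the Cameron-Martin space into the path space -/

theorem norm_setIntegral_le_sqrt_mul_norm
    (f : Lp (EuclideanSpace ℝ (Fin d)) 2 (volume : Measure I)) {A : Set I} (hA : MeasurableSet A) :
    ‖∫ s in A, f s‖ ≤ √(volume.real A) * ‖f‖ := by
  have h := L2.inner_indicatorConstLp_eq_inner_setIntegral ℝ hA (measure_ne_top volume A)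
    (∫ s in A, f s) f
  rw [real_inner_self_eq_norm_sq] at h
  have h2 := real_inner_le_norm (indicatorConstLp 2 hA (measure_ne_top volume A)
    (∫ s in A, f s)) f
  rw [h, norm_indicatorConstLp two_ne_zero ENNReal.ofNat_ne_top, ENNReal.toReal_ofNat,
    ← Real.sqrt_eq_rpow, sq, mul_assoc] at h2
  rcases (norm_nonneg (∫ s in A, f s)).eq_or_lt with h0 | h0
  · rw [← h0]; positivity
  · exact le_of_mul_le_mul_left h2 h0

namespace CameronMartin

theorem norm_path_le (h : CameronMartin d) : ‖path h‖ ≤ ‖h‖ := by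
  refine (ContinuousMap.norm_le _ (norm_nonneg _)).2 fun t => ?_
  rw [(isVelocity_vel h).2, norm_eq]
  refine (norm_setIntegral_le_sqrt_mul_norm _ measurableSet_Icc).trans
    (mul_le_of_le_one_left (norm_nonneg _) ?_)
  exact Real.sqrt_le_one.2 measureReal_le_one

/-- The embedding of `H` into the path space as a bounded operator. -/
def pathCLM : CameronMartin d →L[ℝ] PathSpace d :=
  path.mkContinuous 1 fun h => by simpa using norm_path_le h

/-- The evaluation of an element of `H` at a time `t`, as a bounded operator. -/
def evalCLM (t : I) : CameronMartin d →L[ℝ] EuclideanSpace ℝ (Fin d) :=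
  (ContinuousMap.evalCLM ℝ t).comp pathCLM

@[simp]
theorem evalCLM_apply (t : I) (h : CameronMartin d) : evalCLM t h = path h t := rfl

@[simp]
theorem path_zero (h : CameronMartin d) : path h 0 = 0 := by
  rw [(isVelocity_vel h).2]
  simp

end CameronMartin

/-! ### Delayed perturbations -/

/-- If the increments `ψ i • g i` by which `X` and `Y` differ vanish up to time `s i`, while `g i`
is known from the past of `X` strictly before `s i`, then `X` can be recovered from `Y` in an
adapted way: the `g i` are recovered one after the other, in the order of the times `s i`. -/
theorem usualAugmentation_le_of_delayed {ι : Type*} [Fintype ι] {ψ : ι → I → ℝ}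
    {g : ι → PathSpace d → EuclideanSpace ℝ (Fin d)} {p s : ι → I}
    {c : I → EuclideanSpace ℝ (Fin d)} (hps : ∀ i, p i < s i)
    (hψ : ∀ i u, u ≤ s i → ψ i u = 0)
    (hg : ∀ i, Measurable[usualAugmentation η X (p i)] (g i))
    (hXY : ∀ u, X u =ᵐ[η] fun ω => Y u ω - (∑ i, ψ i u • g i ω + c u)) (t : I) :
    usualAugmentation η X t ≤ usualAugmentation η Y t := by
  have hstep : ∀ u, (∀ i, s i < u → Measurable[usualAugmentation η Y (s i)] (g i)) →
      Measurable[usualAugmentation η Y u] (X u) := by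
    intro u hu
    refine measurable_usualAugmentation_congr ?_ (hXY u)
    refine (measurable_usualAugmentation le_rfl).sub (Measurable.add ?_
      (@measurable_const _ _ _ _ (c u)))
    refine Finset.measurable_fun_sum _ fun i _ => ?_
    by_cases hi : s i < u
    · have hgu : Measurable[usualAugmentation η Y u] (g i) :=
        (hu i hi).mono (usualAugmentation_mono hi.le) le_rfl
      exact hgu.const_smul (ψ i u)
    · simp only [hψ i u (not_lt.1 hi), zero_smul]
      exact @measurable_const _ _ _ _ 0
  have hwf : WellFounded fun i j => s i < s j :=
    @Finite.wellFounded_of_trans_of_irrefl _ _ _ ⟨fun _ _ _ => lt_trans⟩ ⟨fun _ => lt_irrefl _⟩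
  have hgY : ∀ i, Measurable[usualAugmentation η Y (s i)] (g i) := by
    intro i
    induction i using hwf.induction with
    | h i ih =>
      refine (hg i).mono ((usualAugmentation_le_completed (Or.inl (hps i))).trans
        ((completed_mono ?_).trans (completed_usualAugmentation_le _))) le_rfl
      refine iSup₂_le fun u hu => Measurable.comap_le ?_
      exact (hstep u fun j hj => ih j (hj.trans_le hu)).mono (usualAugmentation_mono hu) le_rfl
  exact usualAugmentation_le_of_measurable (fun u => hstep u fun i _ => hgY i) t

/-- Delayed perturbations, up to a deterministic path, are variation processes. -/
theorem mem_variationProcesses_of_delayed [IsProbabilityMeasure η] {ι : Type*} [Fintype ι]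
    {ψ : ι → I → ℝ} {g : ι → PathSpace d → EuclideanSpace ℝ (Fin d)} {p s : ι → I}
    {c : I → EuclideanSpace ℝ (Fin d)} (hps : ∀ i, p i < s i)
    (hψ : ∀ i u, u ≤ s i → ψ i u = 0)
    (hg : ∀ i, Measurable[evalFiltration η (p i)] (g i)) {h : adaptedL2 η}
    (hh : ∀ u, ∀ᵐ ω ∂η, ((h : Lp (CameronMartin d) 2 η) ω).path u = ∑ i, ψ i u • g i ω + c u) :
    h ∈ variationProcesses η := by
  rintro U ⟨hU, hU0⟩
  obtain ⟨hUm, hUeq⟩ := isFilteredIso_iff.1 hU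
  refine ⟨isFilteredIso_iff.2 ⟨?_, fun t => le_antisymm ?_ ?_⟩, ?_⟩
  · exact hUm.add (pathCLM.continuous.comp_aestronglyMeasurable
      (Lp.aestronglyMeasurable (h : Lp (CameronMartin d) 2 η))).aemeasurable
  · refine usualAugmentation_le_of_measurable (fun u => ?_) t
    have hUu : Measurable[evalFiltration η u] fun ω => U ω u :=
      (measurable_usualAugmentation (X := fun u ω => U ω u) le_rfl).mono (hUeq u).le le_rfl
    exact hUu.add (h.2 u)
  · rw [← hUeq t]
    refine usualAugmentation_le_of_delayed (g := g) hps hψ (fun i => ?_) (c := c) (fun u => ?_) t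
    · exact (hg i).mono (hUeq (p i)).ge le_rfl
    · filter_upwards [hh u] with ω hω
      simp [← hω]
  · simpa using hU0

/-! ### Dominated convergence in `L²` -/

theorem tendsto_Lp_two_of_dominated {Ω G : Type*} {mΩ : MeasurableSpace Ω} [NormedAddCommGroup G]
    {μ : Measure Ω} {F : ℕ → Lp G 2 μ} {f : Lp G 2 μ} {b : Ω → ℝ} (hb : MemLp b 2 μ)
    (hbound : ∀ n, ∀ᵐ ω ∂μ, ‖F n ω - f ω‖ ≤ b ω)
    (hlim : ∀ᵐ ω ∂μ, Tendsto (fun n => F n ω) atTop (𝓝 (f ω))) : Tendsto F atTop (𝓝 f) := by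
  rw [Lp.tendsto_Lp_iff_tendsto_eLpNorm']
  have hkey : Tendsto (fun n => ∫⁻ ω, ‖F n ω - f ω‖ₑ ^ (2 : ℝ) ∂μ) atTop (𝓝 (∫⁻ _, 0 ∂μ)) := by
    refine tendsto_lintegral_of_dominated_convergence' (fun ω => ‖b ω‖ₑ ^ (2 : ℝ)) ?_ ?_ ?_ ?_
    · exact fun n => ((Lp.aestronglyMeasurable (F n)).sub
        (Lp.aestronglyMeasurable f)).enorm.pow_const _
    · intro n
      filter_upwards [hbound n] with ω hω
      gcongr
      exact enorm_le_iff_norm_le.2 (hω.trans (Real.le_norm_self _))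
    · have := lintegral_rpow_enorm_lt_top_of_eLpNorm_lt_top two_ne_zero ENNReal.ofNat_ne_top hb.2
      simpa using this.ne
    · filter_upwards [hlim] with ω hω
      have h0 : Tendsto (fun n => ‖F n ω - f ω‖ₑ) atTop (𝓝 0) := by
        have := (hω.sub_const (f ω)).enorm
        simpa using this
      have := (ENNReal.continuous_rpow_const (y := (2 : ℝ))).continuousAt.tendsto.comp h0
      simpa [Function.comp_def] using this
  rw [lintegral_zero] at hkey
  have := (ENNReal.continuous_rpow_const (y := (1 / 2 : ℝ))).continuousAt.tendsto.comp hkey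
  simp only [eLpNorm_eq_lintegral_rpow_enorm_toReal two_ne_zero ENNReal.ofNat_ne_top,
    ENNReal.toReal_ofNat]
  simpa [Function.comp_def] using this

/-! ### Averaging and delaying square integrable functions -/

/-- The node `j / (n + 3)` of the uniform grid of mesh `1 / (n + 3)` (clamped to `1` for
`j > n + 3`). -/
def node (n j : ℕ) : I := Set.projIcc 0 1 zero_le_one ((j : ℝ) / (n + 3))

/-- The `j`-th cell of the uniform grid. -/
def cell (n j : ℕ) : Set I := Set.Ioc (node n j) (node n (j + 1))

theorem coe_node {n j : ℕ} (hj : j ≤ n + 3) : (node n j : ℝ) = j / (n + 3) := by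
  have h : (j : ℝ) ≤ n + 3 := by exact_mod_cast hj
  rw [node, Set.projIcc_of_mem zero_le_one ⟨by positivity, (div_le_one (by positivity)).2 h⟩]

theorem node_mono (n : ℕ) : Monotone (node n) := fun i j hij =>
  Set.monotone_projIcc _ (by gcongr)

theorem node_lt_node {n i j : ℕ} (hij : i < j) (hj : j ≤ n + 3) : node n i < node n j := by
  rw [← Subtype.coe_lt_coe, coe_node (hij.le.trans hj), coe_node hj]
  gcongr

theorem node_zero (n : ℕ) : node n 0 = 0 := by
  ext; simp [coe_node]

theorem measurableSet_cell (n j : ℕ) : MeasurableSet (cell n j) := measurableSet_Ioc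

theorem volume_cell {n j : ℕ} (hj : j < n + 3) : volume.real (cell n j) = 1 / (n + 3) := by
  have h : (0 : ℝ) ≤ 1 / (n + 3) := by positivity
  rw [cell, measureReal_def, unitInterval.volume_Ioc, coe_node hj.le,
    coe_node (Nat.succ_le_of_lt hj), ← sub_div, ENNReal.toReal_ofReal] <;> push_cast <;> rw [add_sub_cancel_left]
  exact h

theorem disjoint_cell {n i j : ℕ} (hij : i ≠ j) : Disjoint (cell n i) (cell n j) :=
  (node_mono n).pairwise_disjoint_on_Ioc_succ hij

theorem exists_mem_cell (n : ℕ) {s : I} (hs : 0 < (s : ℝ)) : ∃ i < n + 3, s ∈ cell n i := by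
  have hn : (0 : ℝ) < n + 3 := by positivity
  obtain ⟨m, hm⟩ : ∃ m, ⌈(s : ℝ) * (n + 3)⌉₊ = m + 1 :=
    Nat.exists_eq_succ_of_ne_zero (Nat.ceil_pos.2 (by positivity)).ne'
  have h1 : (m : ℝ) < s * (n + 3) := by
    have := (Nat.lt_ceil (n := m)).1 (by rw [hm]; exact Nat.lt_succ_self m)
    exact this
  have h2 : (s : ℝ) * (n + 3) ≤ m + 1 := by
    have := Nat.le_ceil ((s : ℝ) * (n + 3))
    rw [hm] at this
    exact_mod_cast this
  have hmn : m < n + 3 := by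
    have : (m : ℝ) < n + 3 := h1.trans_le (mul_le_of_le_one_left hn.le s.2.2)
    exact_mod_cast this
  refine ⟨m, hmn, ?_, ?_⟩
  · rw [← Subtype.coe_lt_coe, coe_node hmn.le, div_lt_iff₀ hn]
    exact h1
  · rw [← Subtype.coe_le_coe, coe_node (Nat.succ_le_of_lt hmn), le_div_iff₀ hn]
    push_cast
    exact h2

/-- The map `x ↦ 1_A x` into `L²([0,1], ℝ^d)`. -/
def stepCLM {A : Set I} (hA : MeasurableSet A) :
    EuclideanSpace ℝ (Fin d) →L[ℝ] Lp (EuclideanSpace ℝ (Fin d)) 2 (volume : Measure I) :=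
  LinearMap.mkContinuous
    { toFun := fun x => indicatorConstLp 2 hA (measure_ne_top volume A) x
      map_add' := fun x y => indicatorConstLp_add.symm
      map_smul' := fun c x => by
        refine Lp.ext ?_
        filter_upwards [indicatorConstLp_coeFn (p := 2) (hs := hA)
          (hμs := measure_ne_top volume A) (c := c • x), indicatorConstLp_coeFn (p := 2) (hs := hA)
          (hμs := measure_ne_top volume A) (c := x),
          Lp.coeFn_smul c (indicatorConstLp 2 hA (measure_ne_top volume A) x)] with s h1 h2 h3
        rw [RingHom.id_apply, h1, h3, Pi.smul_apply, h2]
        by_cases hs : s ∈ A <;> simp [hs] }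
    (√(volume.real A)) fun x => by
      refine (norm_indicatorConstLp (hs := hA) (hμs := measure_ne_top volume A) two_ne_zero
        ENNReal.ofNat_ne_top).le.trans_eq ?_
      rw [ENNReal.toReal_ofNat, ← Real.sqrt_eq_rpow, mul_comm]

theorem stepCLM_apply {A : Set I} (hA : MeasurableSet A) (x : EuclideanSpace ℝ (Fin d)) :
    stepCLM hA x = indicatorConstLp 2 hA (measure_ne_top volume A) x := rfl

theorem norm_stepCLM {A : Set I} (hA : MeasurableSet A) (x : EuclideanSpace ℝ (Fin d)) :
    ‖stepCLM hA x‖ = √(volume.real A) * ‖x‖ := by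
  rw [stepCLM_apply, norm_indicatorConstLp two_ne_zero ENNReal.ofNat_ne_top,
    ENNReal.toReal_ofNat, ← Real.sqrt_eq_rpow, mul_comm]

theorem coeFn_stepCLM {A : Set I} (hA : MeasurableSet A) (x : EuclideanSpace ℝ (Fin d)) :
    stepCLM hA x =ᵐ[volume] A.indicator fun _ => x :=
  indicatorConstLp_coeFn (hs := hA) (hμs := measure_ne_top volume A)

/-- The integral over a set `A` on `L²([0,1], ℝ^d)`. -/
def integralCLM {A : Set I} (hA : MeasurableSet A) :
    Lp (EuclideanSpace ℝ (Fin d)) 2 (volume : Measure I) →L[ℝ] EuclideanSpace ℝ (Fin d) :=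
  LinearMap.mkContinuous
    { toFun := fun f => ∫ s in A, f s
      map_add' := fun f g => by
        rw [integral_congr_ae (ae_restrict_of_ae (Lp.coeFn_add f g))]
        exact integral_add ((Lp.memLp f).integrable one_le_two).integrableOn
          ((Lp.memLp g).integrable one_le_two).integrableOn
      map_smul' := fun c f => by
        rw [integral_congr_ae (ae_restrict_of_ae (Lp.coeFn_smul c f))]
        exact integral_smul c _ }
    (√(volume.real A)) fun f => norm_setIntegral_le_sqrt_mul_norm f hA

theorem integralCLM_apply {A : Set I} (hA : MeasurableSet A)
    (f : Lp (EuclideanSpace ℝ (Fin d)) 2 (volume : Measure I)) :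
    integralCLM hA f = ∫ s in A, f s := rfl

theorem inner_stepCLM {A : Set I} (hA : MeasurableSet A) (x : EuclideanSpace ℝ (Fin d))
    (f : Lp (EuclideanSpace ℝ (Fin d)) 2 (volume : Measure I)) :
    inner ℝ (stepCLM hA x) f = inner ℝ x (integralCLM hA f) :=
  L2.inner_indicatorConstLp_eq_inner_setIntegral ℝ hA (measure_ne_top volume A) x f

theorem inner_stepCLM_stepCLM {A B : Set I} (hA : MeasurableSet A) (hB : MeasurableSet B)
    (x y : EuclideanSpace ℝ (Fin d)) :
    inner ℝ (stepCLM hA x) (stepCLM hB y) = volume.real (A ∩ B) * inner ℝ x y :=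
  L2.inner_indicatorConstLp_indicatorConstLp hA hB (measure_ne_top _ _)
    (measure_ne_top _ _) x y

theorem norm_sq_sum_stepCLM {n k : ℕ} (hk : k ≤ 3) (x : ℕ → EuclideanSpace ℝ (Fin d)) :
    ‖∑ j ∈ Finset.range n, ((n : ℝ) + 3) • stepCLM (measurableSet_cell n (j + k)) (x j)‖ ^ 2 =
      ∑ j ∈ Finset.range n, ((n : ℝ) + 3) * ‖x j‖ ^ 2 := by
  have hn : (n : ℝ) + 3 ≠ 0 := by positivity
  rw [← real_inner_self_eq_norm_sq, sum_inner]
  refine Finset.sum_congr rfl fun i hi => ?_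
  rw [inner_sum, Finset.sum_eq_single i]
  · rw [real_inner_smul_left, real_inner_smul_right, inner_stepCLM_stepCLM, Set.inter_self,
      volume_cell (by have := Finset.mem_range.1 hi; omega), real_inner_self_eq_norm_sq]
    field_simp
  · intro j hj hji
    rw [real_inner_smul_left, real_inner_smul_right, inner_stepCLM_stepCLM,
      (disjoint_cell (by omega)).inter_eq]
    simp
  · exact fun h => absurd hi h

/-- Averages over the cells, moved two cells to the right; what would leave `[0,1]` is put on the
last cell, so that the integral over `[0,1]` is preserved. -/
def delayedAverage (n : ℕ) : Lp (EuclideanSpace ℝ (Fin d)) 2 (volume : Measure I) →L[ℝ]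
    Lp (EuclideanSpace ℝ (Fin d)) 2 (volume : Measure I) :=
  ∑ j ∈ Finset.range n, ((n : ℝ) + 3) •
      (stepCLM (measurableSet_cell n (j + 2))).comp (integralCLM (measurableSet_cell n j)) +
    ((n : ℝ) + 3) • (stepCLM (measurableSet_cell n (n + 2))).comp
      (integralCLM (measurableSet_Ioc (a := node n n) (b := 1)))

theorem delayedAverage_apply (n : ℕ) (f : Lp (EuclideanSpace ℝ (Fin d)) 2 (volume : Measure I)) :
    delayedAverage n f = ∑ j ∈ Finset.range n, ((n : ℝ) + 3) •
        stepCLM (measurableSet_cell n (j + 2)) (integralCLM (measurableSet_cell n j) f) +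
      ((n : ℝ) + 3) • stepCLM (measurableSet_cell n (n + 2))
        (integralCLM (measurableSet_Ioc (a := node n n) (b := 1)) f) := by
  simp [delayedAverage]

theorem volume_Ioc_node (n : ℕ) : volume.real (Set.Ioc (node n n) 1) = 3 / (n + 3) := by
  have hn : (0 : ℝ) < n + 3 := by positivity
  have h : (1 : ℝ) - n / (n + 3) = 3 / (n + 3) := by field_simp; ring
  rw [measureReal_def, unitInterval.volume_Ioc, coe_node (by omega), Set.Icc.coe_one, h,
    ENNReal.toReal_ofReal (by positivity)]

/-- The sum of averages over the cells is an orthogonal projection, and moving the cells does not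
change its norm. -/
theorem norm_sum_stepCLM_integralCLM_le (n : ℕ)
    (f : Lp (EuclideanSpace ℝ (Fin d)) 2 (volume : Measure I)) :
    ‖∑ j ∈ Finset.range n, ((n : ℝ) + 3) •
      stepCLM (measurableSet_cell n (j + 2)) (integralCLM (measurableSet_cell n j) f)‖ ≤ ‖f‖ := by
  set P := ∑ j ∈ Finset.range n, ((n : ℝ) + 3) •
      stepCLM (measurableSet_cell n (j + 0)) (integralCLM (measurableSet_cell n j) f) with hP
  have h1 : ‖P‖ ^ 2 = inner ℝ P f := by
    rw [hP, norm_sq_sum_stepCLM (by omega), sum_inner]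
    refine Finset.sum_congr rfl fun j _ => ?_
    rw [real_inner_smul_left, inner_stepCLM]
    simp only [add_zero, real_inner_self_eq_norm_sq]
  have h2 : ‖P‖ ≤ ‖f‖ := by
    rcases (norm_nonneg P).eq_or_lt with h0 | h0
    · rw [← h0]; positivity
    · refine le_of_mul_le_mul_left ?_ h0
      rw [← sq, h1]
      exact real_inner_le_norm P f
  refine le_trans (le_of_eq ?_) h2
  rw [← sq_eq_sq₀ (norm_nonneg _) (norm_nonneg _), hP, norm_sq_sum_stepCLM (by omega),
    norm_sq_sum_stepCLM (by omega)]

theorem norm_delayedAverage_le (n : ℕ)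
    (f : Lp (EuclideanSpace ℝ (Fin d)) 2 (volume : Measure I)) :
    ‖delayedAverage n f‖ ≤ 3 * ‖f‖ := by
  have hn : (0 : ℝ) < n + 3 := by positivity
  have h2 : ‖((n : ℝ) + 3) • stepCLM (measurableSet_cell n (n + 2))
      (integralCLM (measurableSet_Ioc (a := node n n) (b := 1)) f)‖ ≤ 2 * ‖f‖ := by
    rw [norm_smul, norm_stepCLM, volume_cell (by omega), Real.norm_of_nonneg hn.le]
    calc (n + 3) * (√(1 / (n + 3)) * ‖integralCLM (measurableSet_Ioc (a := node n n) (b := 1)) f‖)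
        ≤ (n + 3) * (√(1 / (n + 3)) * (√(3 / (n + 3)) * ‖f‖)) := by
          gcongr
          rw [← volume_Ioc_node]
          exact norm_setIntegral_le_sqrt_mul_norm f measurableSet_Ioc
      _ = √3 * ‖f‖ := by
          rw [Real.sqrt_div zero_le_one, Real.sqrt_div zero_le_three, Real.sqrt_one]
          have := Real.mul_self_sqrt hn.le
          have h0 : √((n : ℝ) + 3) ≠ 0 := (Real.sqrt_pos.2 hn).ne'
          field_simp
          rw [Real.sq_sqrt hn.le]
      _ ≤ 2 * ‖f‖ := by
          gcongr
          rw [Real.sqrt_le_left (by norm_num)]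
          norm_num
  rw [delayedAverage_apply]
  linarith [norm_add_le (∑ j ∈ Finset.range n, ((n : ℝ) + 3) •
    stepCLM (measurableSet_cell n (j + 2)) (integralCLM (measurableSet_cell n j) f))
    (((n : ℝ) + 3) • stepCLM (measurableSet_cell n (n + 2))
      (integralCLM (measurableSet_Ioc (a := node n n) (b := 1)) f)),
    norm_sum_stepCLM_integralCLM_le n f]

theorem coeFn_delayedAverage (n : ℕ)
    (f : Lp (EuclideanSpace ℝ (Fin d)) 2 (volume : Measure I)) :
    ∀ᵐ s, delayedAverage n f s = ∑ j ∈ Finset.range n, (cell n (j + 2)).indicator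
        (fun _ => ((n : ℝ) + 3) • ∫ t in cell n j, f t) s +
      (cell n (n + 2)).indicator (fun _ => ((n : ℝ) + 3) • ∫ t in Set.Ioc (node n n) 1, f t) s := by
  have hterm : ∀ (k : ℕ) (x : EuclideanSpace ℝ (Fin d)),
      ((n : ℝ) + 3) • stepCLM (measurableSet_cell n k) x =ᵐ[volume]
        (cell n k).indicator fun _ => ((n : ℝ) + 3) • x := fun k x => by
    rw [← map_smul]
    exact coeFn_stepCLM _ _
  have hsum : ∀ m, (∑ j ∈ Finset.range m, ((n : ℝ) + 3) •
      stepCLM (measurableSet_cell n (j + 2)) (integralCLM (measurableSet_cell n j) f) :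
        Lp (EuclideanSpace ℝ (Fin d)) 2 (volume : Measure I)) =ᵐ[volume]
      fun s => ∑ j ∈ Finset.range m, (cell n (j + 2)).indicator
        (fun _ => ((n : ℝ) + 3) • ∫ t in cell n j, f t) s := by
    intro m
    induction m with
    | zero =>
      simp only [Finset.range_zero, Finset.sum_empty]
      exact Lp.coeFn_zero (EuclideanSpace ℝ (Fin d)) 2 (volume : Measure I)
    | succ m ih =>
      rw [Finset.sum_range_succ]
      filter_upwards [Lp.coeFn_add (∑ j ∈ Finset.range m, ((n : ℝ) + 3) •
        stepCLM (measurableSet_cell n (j + 2)) (integralCLM (measurableSet_cell n j) f))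
        (((n : ℝ) + 3) • stepCLM (measurableSet_cell n (m + 2))
          (integralCLM (measurableSet_cell n m) f)), ih,
        hterm (m + 2) (integralCLM (measurableSet_cell n m) f)] with s h1 h2 h3
      rw [h1, Pi.add_apply, h2, h3, Finset.sum_range_succ]
      rfl
  rw [delayedAverage_apply]
  filter_upwards [Lp.coeFn_add (∑ j ∈ Finset.range n, ((n : ℝ) + 3) •
    stepCLM (measurableSet_cell n (j + 2)) (integralCLM (measurableSet_cell n j) f))
    (((n : ℝ) + 3) • stepCLM (measurableSet_cell n (n + 2))
      (integralCLM (measurableSet_Ioc (a := node n n) (b := 1)) f)), hsum n,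
    hterm (n + 2) (integralCLM (measurableSet_Ioc (a := node n n) (b := 1)) f)] with s h1 h2 h3
  rw [h1, Pi.add_apply, h2, h3]
  rfl

/-- At a point of the `i`-th cell, at most one summand does not vanish. -/
theorem sum_indicator_cell_eq {G : Type*} [AddCommMonoid G] {n i : ℕ} {s : I} (hs : s ∈ cell n i)
    (x : ℕ → G) (y : G) :
    ∑ j ∈ Finset.range n, (cell n (j + 2)).indicator (fun _ => x j) s +
      (cell n (n + 2)).indicator (fun _ => y) s =
    (if 2 ≤ i ∧ i < n + 2 then x (i - 2) else 0) + if i = n + 2 then y else 0 := by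
  have h : ∀ k, s ∈ cell n k ↔ i = k := fun k => by
    refine ⟨fun hk => ?_, fun hk => hk ▸ hs⟩
    by_contra hik
    exact Set.disjoint_left.1 (disjoint_cell hik) hs hk
  classical
  simp only [Set.indicator_apply, h]
  congr 1
  split_ifs with hi
  · rw [Finset.sum_eq_single (i - 2)]
    · rw [if_pos (by omega)]
    · intro j _ hj
      rw [if_neg (by omega)]
    · intro hn
      exact absurd (Finset.mem_range.2 (by omega)) hn
  · refine Finset.sum_eq_zero fun j hj => ?_
    have := Finset.mem_range.1 hj
    rw [if_neg (by omega)]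

theorem norm_smul_setIntegral_le {n : ℕ} {A : Set I} {φ : I → EuclideanSpace ℝ (Fin d)} {C c : ℝ}
    (hc : ∀ t ∈ A, ‖φ t‖ ≤ C) (hA : volume.real A = c / (n + 3)) :
    ‖((n : ℝ) + 3) • ∫ t in A, φ t‖ ≤ c * C := by
  have hn : (0 : ℝ) < n + 3 := by positivity
  have h := norm_setIntegral_le_of_norm_le_const (measure_lt_top volume A) hc
  rw [norm_smul, Real.norm_of_nonneg hn.le]
  calc (n + 3) * ‖∫ t in A, φ t‖ ≤ (n + 3) * (C * (c / (n + 3))) := by rw [← hA]; gcongr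
    _ = c * C := by field_simp

theorem tendsto_delayedAverage_toLp (φ : C(I, EuclideanSpace ℝ (Fin d))) :
    Tendsto (fun n => delayedAverage n (ContinuousMap.toLp 2 (volume : Measure I) ℝ φ)) atTop
      (𝓝 (ContinuousMap.toLp 2 (volume : Measure I) ℝ φ)) := by
  have hφ := ContinuousMap.coeFn_toLp (p := 2) (𝕜 := ℝ) (volume : Measure I) φ
  have hval : ∀ n, ∀ᵐ s, delayedAverage n (ContinuousMap.toLp 2 (volume : Measure I) ℝ φ) s =
      ∑ j ∈ Finset.range n, (cell n (j + 2)).indicator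
        (fun _ => ((n : ℝ) + 3) • ∫ t in cell n j, φ t) s +
      (cell n (n + 2)).indicator
        (fun _ => ((n : ℝ) + 3) • ∫ t in Set.Ioc (node n n) 1, φ t) s := by
    intro n
    filter_upwards [coeFn_delayedAverage n (ContinuousMap.toLp 2 (volume : Measure I) ℝ φ)]
      with s hs
    rw [hs]
    simp only [fun A : Set I => integral_congr_ae (ae_restrict_of_ae (s := A) hφ)]
  have hpos : ∀ᵐ s : I, 0 < (s : ℝ) ∧ (s : ℝ) < 1 := by
    have h0 : ∀ᵐ s : I, s ≠ 0 := by simp [ae_iff]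
    have h1 : ∀ᵐ s : I, s ≠ 1 := by simp [ae_iff]
    filter_upwards [h0, h1] with s h0 h1
    exact ⟨unitInterval.pos_iff_ne_zero.2 h0, unitInterval.lt_one_iff_ne_one.2 h1⟩
  refine tendsto_Lp_two_of_dominated (b := fun _ => 4 * ‖φ‖) (memLp_const _) (fun n => ?_) ?_
  · filter_upwards [hval n, hφ, hpos] with s h1 h2 h3
    obtain ⟨i, hi, hsi⟩ := exists_mem_cell n h3.1
    rw [h1, h2, sum_indicator_cell_eq hsi]
    have hb := φ.norm_coe_le_norm s
    have h0 : (0 : ℝ) ≤ ‖φ‖ := norm_nonneg _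
    refine (norm_sub_le _ _).trans ?_
    suffices h : ‖(if 2 ≤ i ∧ i < n + 2 then ((n : ℝ) + 3) • ∫ t in cell n (i - 2), φ t else 0) +
        if i = n + 2 then ((n : ℝ) + 3) • ∫ t in Set.Ioc (node n n) 1, φ t else 0‖ ≤ 3 * ‖φ‖ by
      linarith
    by_cases hi1 : i = n + 2
    · rw [if_neg (by omega), if_pos hi1, zero_add]
      exact norm_smul_setIntegral_le (fun t _ => φ.norm_coe_le_norm t) (volume_Ioc_node n)
    · rw [if_neg hi1, add_zero]
      split_ifs with hi2
      · refine (norm_smul_setIntegral_le (fun t _ => φ.norm_coe_le_norm t)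
          (volume_cell (by omega))).trans ?_
        linarith
      · rw [norm_zero]
        positivity
  · filter_upwards [ae_all_iff.2 hval, hφ, hpos] with s h1 h2 h3
    -- For a fine grid, `s` lies neither in the first two cells nor in the last one, and the value
    -- at `s` is a mean of `φ` over a cell within distance `3 / (n + 3)` of `s`.
    rw [h2, Metric.tendsto_atTop']
    intro ε hε
    obtain ⟨δ, hδ, hcont⟩ := Metric.continuousAt_iff.1 (φ.continuous.continuousAt (x := s))
      (ε / 2) (half_pos hε)
    have hlim : Tendsto (fun n : ℕ => 3 / ((n : ℝ) + 3)) atTop (𝓝 0) :=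
      tendsto_const_nhds.div_atTop (tendsto_atTop_add_const_right _ _ tendsto_natCast_atTop_atTop)
    have hmin : 0 < min δ (min (s : ℝ) (1 - s)) :=
      lt_min hδ (lt_min h3.1 (sub_pos.2 h3.2))
    obtain ⟨N, hN⟩ := eventually_atTop.1 (hlim.eventually (gt_mem_nhds hmin))
    refine ⟨N, fun n hn => ?_⟩
    have hn0 : (0 : ℝ) < n + 3 := by positivity
    obtain ⟨hNδ, hNs, hNs1⟩ := by simpa only [lt_min_iff] using hN n hn.le
    obtain ⟨i, hi, hsi⟩ := exists_mem_cell n h3.1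
    have hsl : (i : ℝ) / (n + 3) < s := by
      rw [← coe_node hi.le]; exact hsi.1
    have hsr : (s : ℝ) ≤ (i + 1) / (n + 3) := by
      have := Subtype.coe_le_coe.2 hsi.2
      rw [coe_node (Nat.succ_le_of_lt hi)] at this
      exact_mod_cast this
    have hi2 : 2 ≤ i := by
      have h : (3 : ℝ) / (n + 3) < (i + 1) / (n + 3) := hNs.trans_le hsr
      rw [div_lt_div_iff_of_pos_right hn0] at h
      have : 3 < i + 1 := by exact_mod_cast h
      omega
    have hi3 : i < n + 2 := by
      have h : (i : ℝ) / (n + 3) < n / (n + 3) := by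
        have : (n : ℝ) / (n + 3) = 1 - 3 / (n + 3) := by field_simp; ring
        rw [this]; linarith
      rw [div_lt_div_iff_of_pos_right hn0] at h
      have : i < n := by exact_mod_cast h
      omega
    rw [h1 n, sum_indicator_cell_eq hsi, if_pos ⟨hi2, hi3⟩, if_neg (by omega), add_zero,
      dist_eq_norm]
    have hvol : volume.real (cell n (i - 2)) = 1 / (n + 3) := volume_cell (by omega)
    have hsub : ((n : ℝ) + 3) • (∫ t in cell n (i - 2), φ t) - φ s =
        ((n : ℝ) + 3) • ∫ t in cell n (i - 2), (φ t - φ s) := by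
      rw [integral_sub (φ.continuous.integrable_of_hasCompactSupport
        (HasCompactSupport.of_compactSpace _)).integrableOn (integrable_const _), setIntegral_const,
        hvol, smul_sub, smul_smul, mul_one_div_cancel hn0.ne', one_smul]
    rw [hsub]
    refine (norm_smul_setIntegral_le (C := ε / 2) (fun t ht => ?_) hvol).trans_lt (by linarith)
    rw [← dist_eq_norm]
    refine (hcont ?_).le
    have htl : ((i : ℝ) - 2) / (n + 3) < t := by
      have := Subtype.coe_lt_coe.2 ht.1
      rw [coe_node (by omega), Nat.cast_sub hi2] at this
      exact_mod_cast this
    have htr : (t : ℝ) ≤ s := by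
      refine le_trans (Subtype.coe_le_coe.2 ht.2) (le_trans ?_ hsl.le)
      rw [coe_node (by omega)]
      gcongr
      omega
    rw [Subtype.dist_eq, Real.dist_eq, abs_sub_comm, abs_of_nonneg (by linarith)]
    have : ((i : ℝ) + 1) / (n + 3) - (i - 2) / (n + 3) = 3 / (n + 3) := by ring
    linarith

/-- On continuous functions the convergence holds by dominated convergence; these are dense, and
the averages are uniformly bounded operators. -/
theorem tendsto_delayedAverage (f : Lp (EuclideanSpace ℝ (Fin d)) 2 (volume : Measure I)) :
    Tendsto (fun n => delayedAverage n f) atTop (𝓝 f) := by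
  rw [Metric.tendsto_atTop']
  intro ε hε
  obtain ⟨_, ⟨φ, rfl⟩, hφ⟩ := Metric.mem_closure_iff.1
    (ContinuousMap.toLp_denseRange (EuclideanSpace ℝ (Fin d)) (volume : Measure I) ℝ
      (p := 2) ENNReal.ofNat_ne_top f) (ε / 5) (by positivity)
  obtain ⟨N, hN⟩ := Metric.tendsto_atTop'.1 (tendsto_delayedAverage_toLp φ) (ε / 5) (by positivity)
  refine ⟨N, fun n hn => ?_⟩
  have h1 := hN n hn
  have h2 := norm_delayedAverage_le n (f - ContinuousMap.toLp 2 (volume : Measure I) ℝ φ)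
  rw [map_sub, ← dist_eq_norm, ← dist_eq_norm] at h2
  set g := ContinuousMap.toLp 2 (volume : Measure I) ℝ φ
  have h3 := dist_triangle4 (delayedAverage n f) (delayedAverage n g) g f
  rw [dist_comm g f] at h3
  linarith

/-! ### Approximation in the Cameron-Martin space -/

namespace CameronMartin

/-- The isometry `h ↦ ḣ` of `H` onto `L²([0,1], ℝ^d)`. -/
def velIso : CameronMartin d ≃ₗᵢ[ℝ] Lp (EuclideanSpace ℝ (Fin d)) 2 (volume : Measure I) :=
  ⟨velEquiv, fun _ => rfl⟩

theorem path_velIso_symm (f : Lp (EuclideanSpace ℝ (Fin d)) 2 (volume : Measure I)) (t : I) :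
    path (velIso.symm f) t = ∫ s in Set.Icc 0 t, f s := by
  rw [(isVelocity_vel _).2, show vel (velIso.symm f) = f from velIso.apply_symm_apply f]

theorem integralCLM_velIso (h : CameronMartin d) {a b : I} (hab : a ≤ b) :
    integralCLM (measurableSet_Ioc (a := a) (b := b)) (velIso h) = path h b - path h a := by
  have hi : Integrable (vel h) volume := (Lp.memLp (vel h)).integrable one_le_two
  have h0 : (0 : I) ≤ a := a.2.1
  rw [integralCLM_apply, (isVelocity_vel h).2, (isVelocity_vel h).2,
    ← Set.Icc_union_Ioc_eq_Icc h0 hab, setIntegral_union ?_ measurableSet_Ioc hi.integrableOn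
      hi.integrableOn, add_sub_cancel_left]
  · rfl
  · exact Set.disjoint_left.2 fun x hx hx' => not_lt.2 hx.2 hx'.1

end CameronMartin

/-- The increment of an element of `H` over the `j`-th cell. -/
def increment (n j : ℕ) : CameronMartin d →L[ℝ] EuclideanSpace ℝ (Fin d) :=
  (integralCLM (measurableSet_cell n j)).comp
    (velIso (d := d)).toContinuousLinearEquiv.toContinuousLinearMap

/-- The element of `H` which grows by `x` on the `(j + 2)`-nd cell, and returns to zero on the last
cell of the grid. -/
def ramp (n j : ℕ) : EuclideanSpace ℝ (Fin d) →L[ℝ] CameronMartin d :=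
  (velIso (d := d)).symm.toContinuousLinearEquiv.toContinuousLinearMap.comp
    (((n : ℝ) + 3) • (stepCLM (measurableSet_cell n (j + 2)) -
      stepCLM (measurableSet_cell n (n + 2))))

/-- The scalar shape of `ramp n j`. -/
def rampShape (n j : ℕ) (t : I) : ℝ :=
  ((n : ℝ) + 3) * (volume.real (cell n (j + 2) ∩ Set.Icc 0 t) -
    volume.real (cell n (n + 2) ∩ Set.Icc 0 t))

theorem increment_apply (n j : ℕ) (h : CameronMartin d) :
    increment n j h = path h (node n (j + 1)) - path h (node n j) :=
  integralCLM_velIso h (node_mono n j.le_succ)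

theorem ramp_apply (n j : ℕ) (x : EuclideanSpace ℝ (Fin d)) :
    ramp n j x = velIso.symm (((n : ℝ) + 3) • (stepCLM (measurableSet_cell n (j + 2)) x -
      stepCLM (measurableSet_cell n (n + 2)) x)) := rfl

theorem path_ramp (n j : ℕ) (x : EuclideanSpace ℝ (Fin d)) (t : I) :
    path (ramp n j x) t = rampShape n j t • x := by
  have hstep : ∀ k, integralCLM (measurableSet_Icc (a := 0) (b := t))
      (stepCLM (measurableSet_cell n k) x) = volume.real (cell n k ∩ Set.Icc 0 t) • x := fun k => by
    rw [integralCLM_apply, stepCLM_apply, setIntegral_indicatorConstLp measurableSet_Icc]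
  rw [ramp_apply, path_velIso_symm, ← integralCLM_apply measurableSet_Icc, map_smul, map_sub, hstep,
    hstep, ← sub_smul, smul_smul, rampShape]

theorem rampShape_eq_zero {n j : ℕ} (hj : j ≤ n) {t : I} (ht : t ≤ node n (j + 2)) :
    rampShape n j t = 0 := by
  have h : ∀ k, j ≤ k → cell n (k + 2) ∩ Set.Icc 0 t = ∅ := fun k hk => by
    refine Set.eq_empty_of_forall_notMem fun s hs => not_lt.2 (hs.2.2.trans ht) ?_
    exact (node_mono n (by omega)).trans_lt hs.1.1
  simp [rampShape, h j le_rfl, h n hj]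

theorem rampShape_one {n j : ℕ} (hj : j ≤ n) : rampShape n j 1 = 0 := by
  have h : Set.Icc (0 : I) 1 = Set.univ := Set.eq_univ_of_forall fun s => s.2
  rw [rampShape, h, Set.inter_univ, Set.inter_univ, volume_cell (by omega), volume_cell (by omega),
    sub_self, mul_zero]

/-- The delayed approximation of `h ∈ H`: each increment is transformed by `φ`, and reproduced two
cells later. -/
def delayedApprox (n : ℕ) (φ : EuclideanSpace ℝ (Fin d) → EuclideanSpace ℝ (Fin d))
    (h : CameronMartin d) : CameronMartin d :=
  ∑ j : Fin n, ramp n j (φ (increment n j h))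

theorem path_delayedApprox (n : ℕ) (φ : EuclideanSpace ℝ (Fin d) → EuclideanSpace ℝ (Fin d))
    (h : CameronMartin d) (t : I) :
    path (delayedApprox n φ h) t = ∑ j : Fin n, rampShape n j t • φ (increment n j h) := by
  rw [delayedApprox, ← evalCLM_apply, map_sum]
  simp only [evalCLM_apply, path_ramp]

theorem delayedApprox_mem_pinned (n : ℕ)
    (φ : EuclideanSpace ℝ (Fin d) → EuclideanSpace ℝ (Fin d)) (h : CameronMartin d) :
    delayedApprox n φ h ∈ pinned d := by
  refine ⟨CameronMartin.path_zero _, ?_⟩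
  rw [path_delayedApprox]
  exact Finset.sum_eq_zero fun j _ => by rw [rampShape_one j.2.le, zero_smul]

theorem norm_delayedApprox_le (n : ℕ) {φ : EuclideanSpace ℝ (Fin d) → EuclideanSpace ℝ (Fin d)}
    (hφ : ∀ x, ‖φ x‖ ≤ ‖x‖) (h : CameronMartin d) :
    ‖delayedApprox n φ h‖ ≤
      (∑ j : Fin n, ‖ramp (d := d) n j‖ * ‖increment (d := d) n j‖) * ‖h‖ := by
  rw [Finset.sum_mul]
  refine norm_sum_le_of_le _ fun j _ => ((ramp n j).le_opNorm _).trans ?_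
  rw [mul_assoc]
  gcongr
  exact (hφ _).trans ((increment n j).le_opNorm h)

theorem norm_delayedApprox_le_of_bounded (n : ℕ)
    {φ : EuclideanSpace ℝ (Fin d) → EuclideanSpace ℝ (Fin d)} {C : ℝ} (hφ : ∀ x, ‖φ x‖ ≤ C)
    (h : CameronMartin d) :
    ‖delayedApprox n φ h‖ ≤ ∑ j : Fin n, ‖ramp (d := d) n j‖ * C := by
  refine norm_sum_le_of_le _ fun j _ => ((ramp n j).le_opNorm _).trans ?_
  gcongr
  exact hφ _

theorem delayedApprox_id (n : ℕ) {h : CameronMartin d} (hh : h ∈ pinned d) :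
    delayedApprox n id h = velIso.symm (delayedAverage n (velIso h)) := by
  have hlast : integralCLM (measurableSet_Ioc (a := node n n) (b := 1)) (velIso h) =
      -∑ j ∈ Finset.range n, integralCLM (measurableSet_cell n j) (velIso h) := by
    have hsum : ∑ j ∈ Finset.range n, integralCLM (measurableSet_cell n j) (velIso h) =
        ∑ j ∈ Finset.range n, (path h (node n (j + 1)) - path h (node n j)) :=
      Finset.sum_congr rfl fun j _ => increment_apply n j h
    rw [integralCLM_velIso h unitInterval.le_one', hh.2, hsum,
      Finset.sum_range_sub (fun j => path h (node n j)), node_zero, hh.1]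
    simp
  rw [delayedAverage_apply, hlast, delayedApprox,
    Finset.sum_range (fun j => integralCLM (measurableSet_cell n j) (velIso h)),
    Finset.sum_range (fun j => ((n : ℝ) + 3) • stepCLM (measurableSet_cell n (j + 2))
      (integralCLM (measurableSet_cell n j) (velIso h))), map_neg, map_sum, smul_neg,
    ← sub_eq_add_neg, Finset.smul_sum, ← Finset.sum_sub_distrib, map_sum]
  refine Finset.sum_congr rfl fun j _ => ?_
  rw [ramp_apply, smul_sub]
  rfl

theorem norm_delayedApprox_id_le (n : ℕ) {h : CameronMartin d} (hh : h ∈ pinned d) :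
    ‖delayedApprox n id h‖ ≤ 3 * ‖h‖ := by
  rw [delayedApprox_id n hh, LinearIsometryEquiv.norm_map]
  exact (norm_delayedAverage_le n _).trans_eq (by rw [LinearIsometryEquiv.norm_map])

theorem tendsto_delayedApprox_id {h : CameronMartin d} (hh : h ∈ pinned d) :
    Tendsto (fun n => delayedApprox n id h) atTop (𝓝 h) := by
  simp only [delayedApprox_id _ hh]
  have := (velIso (d := d)).symm.continuous.continuousAt.tendsto.comp
    (tendsto_delayedAverage (velIso h))
  simpa only [Function.comp_def, LinearIsometryEquiv.symm_apply_apply] using this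

/-- The truncation `x ↦ 1_{|x| ≤ N} x`. -/
def trunc (N : ℕ) (x : EuclideanSpace ℝ (Fin d)) : EuclideanSpace ℝ (Fin d) :=
  (Metric.closedBall 0 N).indicator id x

theorem measurable_trunc (N : ℕ) : Measurable (trunc (d := d) N) :=
  measurable_id.indicator measurableSet_closedBall

theorem norm_trunc_le (N : ℕ) (x : EuclideanSpace ℝ (Fin d)) : ‖trunc N x‖ ≤ ‖x‖ :=
  norm_indicator_le_norm_self id x

theorem trunc_eq_self {N : ℕ} {x : EuclideanSpace ℝ (Fin d)} (hx : ‖x‖ ≤ N) : trunc N x = x :=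
  Set.indicator_of_mem (by simpa using hx) id

theorem norm_trunc_le_natCast (N : ℕ) (x : EuclideanSpace ℝ (Fin d)) : ‖trunc N x‖ ≤ N := by
  by_cases hx : ‖x‖ ≤ N
  · exact (norm_trunc_le N x).trans hx
  · rw [trunc, Set.indicator_of_notMem (by simpa using hx), norm_zero]
    positivity

theorem tendsto_delayedApprox_trunc (n : ℕ) (h : CameronMartin d) :
    Tendsto (fun N => delayedApprox n (trunc N) h) atTop (𝓝 (delayedApprox n id h)) := by
  refine tendsto_finsetSum _ fun j _ => tendsto_const_nhds.congr' ?_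
  obtain ⟨N, hN⟩ := exists_nat_ge ‖increment n j h‖
  filter_upwards [eventually_ge_atTop N] with M hM
  rw [trunc_eq_self (hN.trans (by exact_mod_cast hM)), id]

/-! ### Delayed processes -/

theorem aestronglyMeasurable_delayedApprox (n : ℕ)
    {φ : EuclideanSpace ℝ (Fin d) → EuclideanSpace ℝ (Fin d)} (hφ : Measurable φ)
    {h : PathSpace d → CameronMartin d} (hh : AEStronglyMeasurable h η) :
    AEStronglyMeasurable (fun ω => delayedApprox n φ (h ω)) η := by
  unfold delayedApprox
  refine Finset.aestronglyMeasurable_fun_sum _ fun j _ => ?_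
  refine (ramp n j).continuous.comp_aestronglyMeasurable ?_
  exact (hφ.comp_aemeasurable
    ((increment n j).continuous.comp_aestronglyMeasurable hh).aemeasurable).aestronglyMeasurable

theorem memLp_delayedApprox (n : ℕ)
    {φ : EuclideanSpace ℝ (Fin d) → EuclideanSpace ℝ (Fin d)} (hφ : Measurable φ)
    (hφ' : ∀ x, ‖φ x‖ ≤ ‖x‖) (h : Lp (CameronMartin d) 2 η) :
    MemLp (fun ω => delayedApprox n φ (h ω)) 2 η :=
  (Lp.memLp h).of_le_mul
    (aestronglyMeasurable_delayedApprox n hφ (Lp.aestronglyMeasurable h))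
    (.of_forall fun ω => norm_delayedApprox_le n hφ' (h ω))

theorem measurable_increment (n j : ℕ) (h : adaptedL2 η) :
    Measurable[evalFiltration η (node n (j + 1))]
      fun ω => increment n j ((h : Lp (CameronMartin d) 2 η) ω) := by
  simp only [increment_apply]
  exact (h.2 _).sub ((h.2 _).mono (evalFiltration_mono η (node_mono n j.le_succ)) le_rfl)

/-- The delayed approximation of an adapted process, as an element of `L²_a(η, H)`. -/
def delayedProcess (n : ℕ) {φ : EuclideanSpace ℝ (Fin d) → EuclideanSpace ℝ (Fin d)}
    (hφ : Measurable φ) (hφ' : ∀ x, ‖φ x‖ ≤ ‖x‖) (h : adaptedL2 η) : adaptedL2 η :=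
  ⟨(memLp_delayedApprox n hφ hφ' (h : Lp (CameronMartin d) 2 η)).toLp _, fun t => by
    refine measurable_evalFiltration_congr (f := fun ω => ∑ j : Fin n, rampShape n j t •
      φ (increment n j ((h : Lp (CameronMartin d) 2 η) ω))) ?_ ?_
    · refine Finset.measurable_fun_sum _ fun j _ => ?_
      by_cases ht : t ≤ node n (j + 2)
      · simp only [rampShape_eq_zero j.2.le ht, zero_smul]
        exact @measurable_const _ _ _ _ 0
      · have hj : Measurable[evalFiltration η t]
            fun ω => φ (increment n j ((h : Lp (CameronMartin d) 2 η) ω)) :=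
          hφ.comp ((measurable_increment n j h).mono (evalFiltration_mono η
            ((node_mono n (Nat.le_succ _)).trans (not_le.1 ht).le)) le_rfl)
        exact hj.const_smul (rampShape n j t)
    · filter_upwards [(memLp_delayedApprox n hφ hφ' (h : Lp (CameronMartin d) 2 η)).coeFn_toLp]
        with ω hω
      rw [hω, path_delayedApprox]⟩

theorem coeFn_delayedProcess (n : ℕ)
    {φ : EuclideanSpace ℝ (Fin d) → EuclideanSpace ℝ (Fin d)}
    (hφ : Measurable φ) (hφ' : ∀ x, ‖φ x‖ ≤ ‖x‖) (h : adaptedL2 η) :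
    ∀ᵐ ω ∂η, (delayedProcess n hφ hφ' h : Lp (CameronMartin d) 2 η) ω =
      delayedApprox n φ ((h : Lp (CameronMartin d) 2 η) ω) :=
  (memLp_delayedApprox n hφ hφ' (h : Lp (CameronMartin d) 2 η)).coeFn_toLp

theorem tendsto_delayedProcess_id {h : adaptedL2 η} (hh : h ∈ adaptedL2Pinned η) :
    Tendsto (fun n => delayedProcess n measurable_id (fun _ => le_rfl) h) atTop (𝓝 h) := by
  refine tendsto_subtype_rng.2 (tendsto_Lp_two_of_dominated
    (b := fun ω => 4 * ‖(h : Lp (CameronMartin d) 2 η) ω‖)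
    ((Lp.memLp (h : Lp (CameronMartin d) 2 η)).norm.const_mul 4) (fun n => ?_) ?_)
  · filter_upwards [coeFn_delayedProcess n measurable_id (fun _ => le_rfl) h, hh] with ω h1 h2
    rw [h1]
    linarith [norm_sub_le (delayedApprox n id ((h : Lp (CameronMartin d) 2 η) ω))
      ((h : Lp (CameronMartin d) 2 η) ω), norm_delayedApprox_id_le n h2]
  · filter_upwards [ae_all_iff.2 fun n =>
      coeFn_delayedProcess n measurable_id (fun _ => le_rfl) h, hh] with ω h1 h2
    simpa only [h1] using tendsto_delayedApprox_id h2

theorem tendsto_delayedProcess_trunc (n : ℕ) (h : adaptedL2 η) :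
    Tendsto (fun N => delayedProcess n (measurable_trunc N) (norm_trunc_le N) h) atTop
      (𝓝 (delayedProcess n measurable_id (fun _ => le_rfl) h)) := by
  set C := ∑ j : Fin n, ‖ramp (d := d) n j‖ * ‖increment (d := d) n j‖
  refine tendsto_subtype_rng.2 (tendsto_Lp_two_of_dominated
    (b := fun ω => 2 * C * ‖(h : Lp (CameronMartin d) 2 η) ω‖)
    ((Lp.memLp (h : Lp (CameronMartin d) 2 η)).norm.const_mul (2 * C)) (fun N => ?_) ?_)
  · filter_upwards [coeFn_delayedProcess n measurable_id (fun _ => le_rfl) h,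
      coeFn_delayedProcess n (measurable_trunc N) (norm_trunc_le N) h] with ω h1 h2
    rw [h1, h2]
    linarith [norm_sub_le (delayedApprox n (trunc N) ((h : Lp (CameronMartin d) 2 η) ω))
      (delayedApprox n id ((h : Lp (CameronMartin d) 2 η) ω)),
      norm_delayedApprox_le n (φ := id) (fun _ => le_rfl) ((h : Lp (CameronMartin d) 2 η) ω),
      norm_delayedApprox_le n (norm_trunc_le N) ((h : Lp (CameronMartin d) 2 η) ω)]
  · filter_upwards [coeFn_delayedProcess n measurable_id (fun _ => le_rfl) h, ae_all_iff.2 fun N =>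
      coeFn_delayedProcess n (measurable_trunc N) (norm_trunc_le N) h] with ω h1 h2
    simpa only [h1, h2] using tendsto_delayedApprox_trunc n ((h : Lp (CameronMartin d) 2 η) ω)

/-! ### Centering -/

section Centering

/-- Paths of `H` start at zero, so only the terminal value matters. -/
theorem mem_adaptedL2Pinned_iff {h : adaptedL2 η} : h ∈ adaptedL2Pinned η ↔
    (evalCLM (d := d) 1).compLpL 2 η (h : Lp (CameronMartin d) 2 η) = 0 := by
  rw [Lp.eq_zero_iff_ae_eq_zero]
  have hc := (evalCLM (d := d) 1).coeFn_compLpL (p := 2) (μ := η) (h : Lp (CameronMartin d) 2 η)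
  constructor
  · intro hh
    filter_upwards [hc, hh] with ω h1 h2
    rw [h1]
    exact h2.2
  · intro hh
    filter_upwards [hc, hh] with ω h1 h2
    refine ⟨CameronMartin.path_zero _, ?_⟩
    rw [h1] at h2
    exact h2

theorem isClosed_adaptedL2Pinned : IsClosed (adaptedL2Pinned (d := d) η) := by
  have : adaptedL2Pinned (d := d) η = (fun h : adaptedL2 η =>
      (evalCLM (d := d) 1).compLpL 2 η (h : Lp (CameronMartin d) 2 η)) ⁻¹' {0} :=
    Set.ext fun h => mem_adaptedL2Pinned_iff
  rw [this]
  exact isClosed_singleton.preimage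
    (((evalCLM (d := d) 1).compLpL 2 η).continuous.comp continuous_subtype_val)

variable [IsProbabilityMeasure η]

theorem integrable_coeFn (h : Lp (CameronMartin d) 2 η) : Integrable h η :=
  (Lp.memLp h).integrable one_le_two

theorem norm_mean_le (h : adaptedL2 η) : ‖mean η h‖ ≤ ‖h‖ := by
  refine (norm_integral_le_integral_norm _).trans ?_
  rw [Submodule.coe_norm, Lp.norm_def, integral_norm_eq_lintegral_enorm (Lp.aestronglyMeasurable _),
    ← eLpNorm_one_eq_lintegral_enorm]
  exact ENNReal.toReal_mono (Lp.eLpNorm_ne_top _)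
    (eLpNorm_le_eLpNorm_of_exponent_le one_le_two (Lp.aestronglyMeasurable _))

theorem mean_sub (h k : adaptedL2 η) : mean η (h - k) = mean η h - mean η k := by
  rw [mean, mean, mean, ← integral_sub (integrable_coeFn _) (integrable_coeFn _)]
  exact integral_congr_ae (Lp.coeFn_sub _ _)

theorem continuous_mean : Continuous (mean η) :=
  (LipschitzWith.of_dist_le_mul (K := 1) fun h k => by
    rw [dist_eq_norm, dist_eq_norm, ← mean_sub, NNReal.coe_one, one_mul]
    exact norm_mean_le _).continuous

/-- A deterministic element of `L²_a(η, H)`. -/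
def constProcess (η : Measure (PathSpace d)) [IsProbabilityMeasure η] (x : CameronMartin d) :
    adaptedL2 η :=
  ⟨Lp.const 2 η x, fun t => by
    refine measurable_evalFiltration_congr (f := fun _ => path x t)
      (@measurable_const _ _ _ _ (path x t)) ?_
    filter_upwards [Lp.coeFn_const 2 η x] with ω hω
    rw [hω, Function.const_apply]⟩

theorem coeFn_constProcess (x : CameronMartin d) :
    ∀ᵐ ω ∂η, (constProcess η x : Lp (CameronMartin d) 2 η) ω = x :=
  Lp.coeFn_const 2 η x

theorem continuous_constProcess : Continuous (constProcess (d := d) η) :=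
  (Lp.constL 2 η ℝ : CameronMartin d →L[ℝ] _).continuous.subtype_mk _

/-- The centered process `h - E[h]`. -/
def center (h : adaptedL2 η) : adaptedL2 η := h - constProcess η (mean η h)

theorem continuous_center : Continuous (center (d := d) (η := η)) :=
  continuous_id.sub (continuous_constProcess.comp continuous_mean)

theorem coeFn_center (h : adaptedL2 η) : ∀ᵐ ω ∂η, (center h : Lp (CameronMartin d) 2 η) ω =
    (h : Lp (CameronMartin d) 2 η) ω - mean η h := by
  filter_upwards [Lp.coeFn_sub (h : Lp (CameronMartin d) 2 η)
    (constProcess η (mean η h) : Lp (CameronMartin d) 2 η), coeFn_constProcess (η := η) (mean η h)]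
    with ω h1 h2
  rw [← h2]
  exact h1

theorem mean_center (h : adaptedL2 η) : mean η (center h) = 0 := by
  rw [center, mean_sub, sub_eq_zero, mean, mean, integral_congr_ae (coeFn_constProcess _)]
  simp

theorem center_eq_self {h : adaptedL2 η} (hh : mean η h = 0) : center h = h := by
  have : constProcess η (0 : CameronMartin d) = 0 := Subtype.ext (map_zero (Lp.constL 2 η ℝ))
  rw [center, hh, this, sub_zero]

theorem mean_mem_pinned {h : adaptedL2 η} (hh : h ∈ adaptedL2Pinned η) :
    mean η h ∈ pinned d := by
  refine ⟨CameronMartin.path_zero _, ?_⟩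
  rw [← evalCLM_apply, mean, ← (evalCLM 1).integral_comp_comm (integrable_coeFn _)]
  refine integral_eq_zero_of_ae ?_
  filter_upwards [hh] with ω hω using hω.2

theorem center_mem_adaptedL2Pinned {h : adaptedL2 η} (hh : h ∈ adaptedL2Pinned η) :
    center h ∈ adaptedL2Pinned η := by
  have hc : ∀ᵐ ω ∂η, (center h : Lp (CameronMartin d) 2 η) ω ∈ pinned d := by
    filter_upwards [coeFn_center h, hh] with ω h1 h2
    rw [h1]
    exact sub_mem h2 (mean_mem_pinned hh)
  exact hc

/-- A centered delayed process with bounded increments is an average preserving variation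
process. -/
theorem center_delayedProcess_mem_avgPreserving (n : ℕ)
    {φ : EuclideanSpace ℝ (Fin d) → EuclideanSpace ℝ (Fin d)} (hφ : Measurable φ)
    (hφ' : ∀ x, ‖φ x‖ ≤ ‖x‖) {C : ℝ} (hC : ∀ x, ‖φ x‖ ≤ C) (h : adaptedL2 η) :
    center (delayedProcess n hφ hφ' h) ∈ avgPreserving η := by
  have hk := coeFn_delayedProcess n hφ hφ' h
  have hc := coeFn_center (delayedProcess n hφ hφ' h)
  set m := mean η (delayedProcess n hφ hφ' h)
  refine ⟨⟨⟨?_, ?_⟩, center_mem_adaptedL2Pinned ?_⟩, mean_center _⟩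
  · refine mem_variationProcesses_of_delayed (ι := Fin n) (p := fun j => node n (j + 1))
      (s := fun j => node n (j + 2)) (ψ := fun j => rampShape n j)
      (g := fun j ω => φ (increment n j ((h : Lp (CameronMartin d) 2 η) ω)))
      (c := fun u => -path m u) (fun j => node_lt_node (by omega) (by omega))
      (fun j u hu => rampShape_eq_zero j.2.le hu) (fun j => hφ.comp (measurable_increment n j h))
      fun u => ?_
    filter_upwards [hk, hc] with ω h1 h2
    rw [h2, h1, map_sub, ContinuousMap.sub_apply, path_delayedApprox, sub_eq_add_neg]
  · have hC0 : 0 ≤ C := (norm_nonneg _).trans (hC 0)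
    refine ⟨∑ j : Fin n, ‖ramp (d := d) n j‖ * C + ‖m‖ + 1, by positivity, ?_⟩
    filter_upwards [hk, hc] with ω h1 h2
    rw [h2, h1]
    linarith [norm_path_le (delayedApprox n φ ((h : Lp (CameronMartin d) 2 η) ω) - m),
      norm_sub_le (delayedApprox n φ ((h : Lp (CameronMartin d) 2 η) ω)) m,
      norm_delayedApprox_le_of_bounded n hC ((h : Lp (CameronMartin d) 2 η) ω)]
  · filter_upwards [hk] with ω h1
    rw [h1]
    exact delayedApprox_mem_pinned n φ _

end Centering

end AvgPreserving

end

theorem proposition3p2 (d : ℕ) (ν : MeasureTheory.Measure (AvgPreserving.PathSpace d))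
    (hν : ν ∈ AvgPreserving.semimartingaleLaws d) :
    closure (AvgPreserving.avgPreserving ν) =
      {h : AvgPreserving.adaptedL2 ν |
        h ∈ AvgPreserving.adaptedL2Pinned ν ∧ AvgPreserving.mean ν h = 0} := by
  have : IsProbabilityMeasure ν := hν.1
  refine Set.Subset.antisymm (closure_minimal (fun h hh => ⟨hh.1.2, hh.2⟩) ?_) ?_
  · exact AvgPreserving.isClosed_adaptedL2Pinned.inter
      (isClosed_singleton.preimage AvgPreserving.continuous_mean)
  · rintro h ⟨hpin, hmean⟩
    -- Centering is continuous and fixes `h`, so it is enough to approximate `h` by delayed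
    -- processes with bounded increments; first refine the grid, then release the truncation.
    have hmem : h ∈ closure (AvgPreserving.center ⁻¹' AvgPreserving.avgPreserving ν) := by
      refine isClosed_closure.mem_of_tendsto (AvgPreserving.tendsto_delayedProcess_id hpin)
        (Filter.Eventually.of_forall fun n => ?_)
      exact mem_closure_of_tendsto (AvgPreserving.tendsto_delayedProcess_trunc n h)
        (Filter.Eventually.of_forall fun N =>
          AvgPreserving.center_delayedProcess_mem_avgPreserving n _ _
            (AvgPreserving.norm_trunc_le_natCast N) h)
    rw [← AvgPreserving.center_eq_self hmean]
    exact map_mem_closure AvgPreserving.continuous_center hmem fun _ hk => hk
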